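/- **Theorem (variational formulation for the localized Hamiltonian operator).** Let $n\ge 3$, $R>0$, $P\ge 2$ and $p\in(0,n-2)$. Let $K\subset\mathbb R^n\setminus\{0\}$ be an open cone whose boundary is smooth away from the tip $0$ (the case $K=\mathbb R^n\setminus\{0\}$ is allowed), put $\Lambda=K\cap S^{n-1}$ and $\Omega_R=\{x\in K:\ |x|>R\}$, and let $\lambda:K\to(0,\infty)$ be a localization function: $\lambda$ is of class $C^2$, depends on $x/|x|$ only, vanishes linearly at the boundary, i.e. $c\,\mathrm{dist}(x,K^{c})\le |x|\lambda(x)\le C\,\mathrm{dist}(x,K^{c})$ on $K$ for some constants $0<c\le C$ (in particular $\lambda$ is bounded), and its support $\overline{\Lambda}$ is connected. Write $r=|x|$ and $\omega_p=r^{n/2-p}\lambda^{P}$. For $q\in\mathbb R$ let $\|f\|_{L^2_{q,-P}(\Omega_R)}^2=\int_{\Omega_R}|f|^2r^{2q-n}\lambda^{2P}\,dx$, and let $H^2_{q,-P}(\Omega_R)$ be the completion of the smooth functions on $\Omega_R$ with finite norm $$\|u\|^2_{H^2_{q,-P}}=\|u\|^2_{L^2_{q,-P}}+\sum_i\|\partial_iu\|^2_{L^2_{q+1,-P}}+\sum_{i,j}\|\partial_i\partial_ju\|^2_{L^2_{q+2,-P}}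 .$$ With $a=2(n-2-p)$, $b=2+(n-3)(n-2-a)$, $\vartheta=r\partial_r$, and $\nabla\!\!\!\!/$, $\Delta\!\!\!\!/$ the gradient and Laplacian of the unit sphere acting in the angular variables, set $$\mathcal H^\lambda[u]=\omega_p^{-2}\Bigl((n-2)\Delta(\omega_p^2\Delta u)+\sum_{i,j}\partial_i\partial_j(\omega_p^2\,\partial_i\partial_ju)\Bigr),$$ $$\mathbb A_3^\lambda[u]=(n-1)\vartheta(\vartheta^2+a\vartheta-b)u+2\lambda^{-2P}\nabla\!\!\!\!/\cdot\bigl(\lambda^{2P}\nabla\!\!\!\!/(\vartheta u-u)\bigr)+\bigl((n-2)\vartheta-(n-2)(n-2-a)-1\bigr)\Delta\!\!\!\!/\,u,$$ $$\mathbb A_2^\lambda[u]=\vartheta\bigl((n-1)\vartheta+(n-2)^2-1\bigr)u+(n-2)\Delta\!\!\!\!/\,u .$$ Let $E\in L^2_{n-p+2,-P}(\Omega_R)$ and consider the boundary value problem $$\mathcal H^\lambda[u]=E\ \text{ in }\Omega_R,\qquad \mathbb A_3^\lambda[u]=\mathbb A_2^\lambda[u]=0\ \text{ on } S_R\cap K.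 \qquad(\ast)$$ A *variational solution* of $(\ast)$ is a function $u\in H^2_{n-p-2,-P}(\Omega_R)$ such that, for all $w\in H^2_{n-p-2,-P}(\Omega_R)$, $$\int_{\Omega_R}\sum_{i,j}(\partial_i\partial_jw-\delta_{ij}\Delta w)(\partial_i\partial_ju-\delta_{ij}\Delta u)\,\omega_p^2\,dx=\int_{\Omega_R}w\,E\,\omega_p^2\,dx .$$ Then there exists a unique (up to equality almost everywhere) variational solution $u$ of $(\ast)$. It solves $(\ast)$ in the following sense: if it has a representative of class $C^4$ on a neighbourhood of $\{x\in K:\ |x|\ge R\}$, then this representative satisfies $\mathcal H^\lambda[u]=E$ almost everywhere in $\Omega_R$ and $\mathbb A_3^\lambda[u]=\mathbb A_2^\lambda[u]=0$ at every point of $S_R\cap K$. -/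

import Mathlib

open MeasureTheory
open scoped ENNReal ContDiff

namespace LocHam

noncomputable section

/-- Euclidean space `ℝⁿ`. -/
abbrev E (n : ℕ) : Type := EuclideanSpace ℝ (Fin n)

/-! ### Conical domains and localization functions -/

/-- `K` is an open cone of `ℝⁿ` (its tip is not a point of `K`, so that the unlocalized case is
`K = ℝⁿ ∖ {0}`, `lam = 1`) with smooth boundary away from the tip, and `lam` is a localization
function on `K`: it is positive, depends on the angular variable `x / |x|` only, vanishes linearly
at the boundary of the cone, and has connected support (the closure of `Λ = K ∩ Sⁿ⁻¹`).
Only the values of `lam` on `K` matter. -/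
structure IsConicalLocalization {n : ℕ} (K : Set (E n)) (lam : E n → ℝ) : Prop where
  isOpen : IsOpen K
  zero_notMem : (0 : E n) ∉ K
  smul_mem : ∀ x ∈ K, ∀ t : ℝ, 0 < t → t • x ∈ K
  smooth_boundary : ∀ x ∈ frontier K, x ≠ 0 → ∃ (U : Set (E n)) (ρ : E n → ℝ),
    IsOpen U ∧ x ∈ U ∧ ContDiffOn ℝ ∞ ρ U ∧ fderiv ℝ ρ x ≠ 0 ∧ K ∩ U = {y ∈ U | ρ y < 0}
  connected_support : IsConnected (closure (K ∩ Metric.sphere (0 : E n) 1))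
  regular : ContDiffOn ℝ 2 lam K
  pos : ∀ x ∈ K, 0 < lam x
  angular : ∀ x ∈ K, ∀ t : ℝ, 0 < t → lam (t • x) = lam x
  linear_vanishing : ∃ c C : ℝ, 0 < c ∧ ∀ x ∈ K,
    c * Metric.infDist x Kᶜ ≤ ‖x‖ * lam x ∧ ‖x‖ * lam x ≤ C * Metric.infDist x Kᶜ

/-- The truncated cone `Ω_R = K ∩ {|x| > R}`. -/
def Om {n : ℕ} (K : Set (E n)) (R : ℝ) : Set (E n) := K ∩ {x | R < ‖x‖}

/-! ### Weighted spaces -/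

/-- The measure `r^{2q-n} lam^{2P} dx` on `Ω_R`, so that the norm of `L²_{q,-P}(Ω_R)` is the
`L²` norm of this measure. -/
def wMeasure {n : ℕ} (K : Set (E n)) (lam : E n → ℝ) (P R q : ℝ) : Measure (E n) :=
  (volume.restrict (Om K R)).withDensity
    (fun x => ENNReal.ofReal (‖x‖ ^ (2 * q - n) * lam x ^ (2 * P)))

/-- `f ∈ L²_{q,-P}(Ω_R)`. -/
def MemWL2 {n : ℕ} (K : Set (E n)) (lam : E n → ℝ) (P R q : ℝ) (f : E n → ℝ) : Prop :=
  MemLp f 2 (wMeasure K lam P R q)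

/-- The norm of `L²_{q,-P}(Ω_R)`, with values in `[0,∞]`. -/
def wNorm {n : ℕ} (K : Set (E n)) (lam : E n → ℝ) (P R q : ℝ) (f : E n → ℝ) : ℝ≥0∞ :=
  eLpNorm f 2 (wMeasure K lam P R q)

/-- The Cartesian partial derivative `∂_i f`. -/
def pd {n : ℕ} (i : Fin n) (f : E n → ℝ) (x : E n) : ℝ :=
  fderiv ℝ f x (EuclideanSpace.single i 1)

/-- `u` belongs to `H²_{q,-P}(Ω_R)`, with gradient `G` and Hessian `D`. The space is the completion
of the smooth functions on the open set `Ω_R` for the norm whose square is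
`‖u‖²_{L²_{q,-P}} + ∑ ‖∂_i u‖²_{L²_{q+1,-P}} + ∑ ‖∂_i ∂_j u‖²_{L²_{q+2,-P}}`:
`(u, G, D)` is approximated in this norm by smooth functions and their derivatives. -/
structure IsH2With {n : ℕ} (K : Set (E n)) (lam : E n → ℝ) (P R q : ℝ)
    (u : E n → ℝ) (G : Fin n → E n → ℝ) (D : Fin n → Fin n → E n → ℝ) : Prop where
  mem : MemWL2 K lam P R q u
  mem_grad : ∀ i, MemWL2 K lam P R (q + 1) (G i)
  mem_hess : ∀ i j, MemWL2 K lam P R (q + 2) (D i j)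
  approx : ∀ ε : ℝ≥0∞, 0 < ε → ∃ φ : E n → ℝ, ContDiffOn ℝ ∞ φ (Om K R) ∧
    wNorm K lam P R q (fun x => u x - φ x) < ε ∧
    (∀ i, wNorm K lam P R (q + 1) (fun x => G i x - pd i φ x) < ε) ∧
    (∀ i j, wNorm K lam P R (q + 2) (fun x => D i j x - pd i (pd j φ) x) < ε)

/-! ### Variational solutions -/

/-- The variational weight `ω_p = r^{n/2-p} lam^P`. -/
def omega {n : ℕ} (lam : E n → ℝ) (P p : ℝ) (x : E n) : ℝ :=
  ‖x‖ ^ ((n : ℝ) / 2 - p) * lam x ^ P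

/-- The matrix field `∂_i ∂_j u - δ_{ij} Δ u`, in terms of the Hessian `D` of `u`. -/
def adjH {n : ℕ} (D : Fin n → Fin n → E n → ℝ) (i j : Fin n) (x : E n) : ℝ :=
  D i j x - if i = j then ∑ k, D k k x else 0

/-- `u ∈ H²_{n-p-2,-P}(Ω_R)` is a variational solution of the localized Hamiltonian boundary value
problem with source `f`: for all `w ∈ H²_{n-p-2,-P}(Ω_R)`,
`∫ (∂_i∂_j w - δ_{ij} Δw) (∂_i∂_j u - δ_{ij} Δu) ω_p² dx = ∫ w f ω_p² dx` over `Ω_R`. -/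
def IsVariationalSolution {n : ℕ} (K : Set (E n)) (lam : E n → ℝ) (P R p : ℝ)
    (f u : E n → ℝ) : Prop :=
  ∃ (G : Fin n → E n → ℝ) (D : Fin n → Fin n → E n → ℝ),
    IsH2With K lam P R (n - p - 2) u G D ∧
    ∀ (w : E n → ℝ) (G' : Fin n → E n → ℝ) (D' : Fin n → Fin n → E n → ℝ),
      IsH2With K lam P R (n - p - 2) w G' D' →
      ∫ x in Om K R, (∑ i, ∑ j, adjH D' i j x * adjH D i j x) * omega lam P p x ^ 2
        = ∫ x in Om K R, w x * f x * omega lam P p x ^ 2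

/-! ### The operators -/

/-- The Laplacian `Δ f`. -/
def lap {n : ℕ} (f : E n → ℝ) (x : E n) : ℝ := ∑ i, pd i (pd i f) x

/-- The localized Hamiltonian operator
`ω_p⁻² ((n-2) Δ (ω_p² Δ u) + ∂_i ∂_j (ω_p² ∂_i ∂_j u))`. -/
def hamOp {n : ℕ} (lam : E n → ℝ) (P p : ℝ) (u : E n → ℝ) (x : E n) : ℝ :=
  (omega lam P p x ^ 2)⁻¹ *
    (((n : ℝ) - 2) * lap (fun y => omega lam P p y ^ 2 * lap u y) x
      + ∑ i, ∑ j, pd i (pd j (fun y => omega lam P p y ^ 2 * pd i (pd j u) y)) x)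

/-- The radial derivative `ϑ f = r ∂_r f = x_i ∂_i f`. -/
def theta {n : ℕ} (f : E n → ℝ) (x : E n) : ℝ := fderiv ℝ f x x

/-- The `i`-th Cartesian component `r ∂_i f - (x_i / r) ϑ f` of the spherical gradient of `f`. -/
def dsl {n : ℕ} (i : Fin n) (f : E n → ℝ) (x : E n) : ℝ :=
  ‖x‖ * pd i f x - x i / ‖x‖ * theta f x

/-- The spherical divergence of a tangential vector field with Cartesian components `X i`. -/
def divS {n : ℕ} (X : Fin n → E n → ℝ) (x : E n) : ℝ := ∑ i, dsl i (X i) x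

/-- The spherical Laplacian. -/
def lapS {n : ℕ} (f : E n → ℝ) (x : E n) : ℝ := divS (fun i => dsl i f) x

/-- `a_{n,p} = 2 (n-2-p)`. -/
def aC (n : ℕ) (p : ℝ) : ℝ := 2 * ((n : ℝ) - 2 - p)

/-- `b_{n,p} = 2 + (n-3) (n-2-a_{n,p})`. -/
def bC (n : ℕ) (p : ℝ) : ℝ := 2 + ((n : ℝ) - 3) * ((n : ℝ) - 2 - aC n p)

/-- The third-order boundary operator. -/
def bdryA3 {n : ℕ} (lam : E n → ℝ) (P p : ℝ) (u : E n → ℝ) (x : E n) : ℝ :=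
  ((n : ℝ) - 1) * theta (fun y => theta (theta u) y + aC n p * theta u y - bC n p * u y) x
    + 2 * (lam x ^ (2 * P))⁻¹ *
        divS (fun i y => lam y ^ (2 * P) * dsl i (fun z => theta u z - u z) y) x
    + (((n : ℝ) - 2) * theta (lapS u) x
        - (((n : ℝ) - 2) * ((n : ℝ) - 2 - aC n p) + 1) * lapS u x)

/-- The second-order boundary operator. -/
def bdryA2 {n : ℕ} (u : E n → ℝ) (x : E n) : ℝ :=
  theta (fun y => ((n : ℝ) - 1) * theta u y + (((n : ℝ) - 2) ^ 2 - 1) * u y) x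
    + ((n : ℝ) - 2) * lapS u x

/-- `u` is of class `C⁴` in `Ω_R` up to the boundary piece `S_R ∩ K`. -/
def IsRegular {n : ℕ} (K : Set (E n)) (R : ℝ) (u : E n → ℝ) : Prop :=
  ∃ U : Set (E n), IsOpen U ∧ K ∩ {x | R ≤ ‖x‖} ⊆ U ∧ ContDiffOn ℝ 4 u U

/-- `u` solves the boundary value problem in the classical sense: the equation holds (almost
everywhere) in `Ω_R` and the two boundary conditions hold at every point of `S_R ∩ K`. -/
def IsClassicalSolution {n : ℕ} (K : Set (E n)) (lam : E n → ℝ) (P R p : ℝ)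
    (f u : E n → ℝ) : Prop :=
  (∀ᵐ x ∂(volume.restrict (Om K R)), hamOp lam P p u x = f x) ∧
    ∀ x ∈ K, ‖x‖ = R → bdryA3 lam P p u x = 0 ∧ bdryA2 u x = 0

end

end LocHam

namespace LocHam

open Set
open scoped NNReal

variable {n : ℕ} {K : Set (E n)} {lam : E n → ℝ} {P R q : ℝ}

namespace IsConicalLocalization

theorem ne_zero (hK : IsConicalLocalization K lam) {x : E n} (hx : x ∈ K) : x ≠ 0 :=
  fun h => hK.zero_notMem (h ▸ hx)

theorem isOpen_Om (hK : IsConicalLocalization K lam) : IsOpen (Om K R) :=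
  hK.isOpen.inter (isOpen_lt continuous_const continuous_norm)

theorem smul_mem_Om (hK : IsConicalLocalization K lam) {x : E n} (hx : x ∈ Om K R) {t : ℝ}
    (ht : 1 ≤ t) : t • x ∈ Om K R := by
  refine ⟨hK.smul_mem x hx.1 t (by linarith), ?_⟩
  have h : R < ‖x‖ := hx.2
  simp only [mem_ofPred_eq, norm_smul, Real.norm_eq_abs, abs_of_nonneg (by linarith : (0:ℝ) ≤ t)]
  nlinarith [norm_nonneg x]

end IsConicalLocalization

/-- The density `r^{2q-n} lam^{2P}` of the weighted measures. -/
noncomputable def wt (lam : E n → ℝ) (P q : ℝ) (x : E n) : ℝ :=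
  ‖x‖ ^ (2 * q - n) * lam x ^ (2 * P)

theorem wt_pos (hK : IsConicalLocalization K lam) {x : E n} (hx : x ∈ K) : 0 < wt lam P q x :=
  mul_pos (Real.rpow_pos_of_pos (norm_pos_iff.2 (hK.ne_zero hx)) _)
    (Real.rpow_pos_of_pos (hK.pos x hx) _)

theorem contDiffOn_wt (hK : IsConicalLocalization K lam) : ContDiffOn ℝ 2 (wt lam P q) K := by
  apply ContDiffOn.mul
  · apply ContDiffOn.rpow_const_of_ne
    · exact fun x hx => (contDiffAt_norm ℝ (hK.ne_zero hx)).contDiffWithinAt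
    · exact fun x hx => norm_ne_zero_iff.2 (hK.ne_zero hx)
  · exact hK.regular.rpow_const_of_ne fun x hx => (hK.pos x hx).ne'

theorem aemeasurable_wt (hK : IsConicalLocalization K lam) :
    AEMeasurable (wt lam P q) (volume.restrict (Om K R)) :=
  ((contDiffOn_wt hK).continuousOn.mono inter_subset_left).aemeasurable hK.isOpen_Om.measurableSet

theorem wt_smul (hK : IsConicalLocalization K lam) {x : E n} (hx : x ∈ K) {t : ℝ} (ht : 0 < t) :
    wt lam P q (t • x) = t ^ (2 * q - n) * wt lam P q x := by
  rw [wt, wt, hK.angular x hx t ht, norm_smul, Real.norm_of_nonneg ht.le,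
    Real.mul_rpow ht.le (norm_nonneg x), mul_assoc]

theorem norm_sq_mul_wt (hK : IsConicalLocalization K lam) {x : E n} (hx : x ∈ K) :
    ‖x‖ ^ 2 * wt lam P q x = wt lam P (q + 1) x := by
  rw [wt, wt, ← mul_assoc, ← Real.rpow_natCast, ← Real.rpow_add (norm_pos_iff.2 (hK.ne_zero hx))]
  congr 2
  push_cast
  ring

theorem wMeasure_eq : wMeasure K lam P R q =
    (volume.restrict (Om K R)).withDensity (fun x => ENNReal.ofReal (wt lam P q x)) := rfl

theorem lintegral_wMeasure (hK : IsConicalLocalization K lam) (g : E n → ℝ≥0∞) :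
    ∫⁻ x, g x ∂(wMeasure K lam P R q) = ∫⁻ x in Om K R, ENNReal.ofReal (wt lam P q x) * g x := by
  rw [wMeasure_eq, lintegral_withDensity_eq_lintegral_mul_non_measurable₀ _
    (aemeasurable_wt hK).ennreal_ofReal (by simp)]
  rfl

theorem lintegral_comp_smul (g : E n → ℝ≥0∞) {t : ℝ} (ht : 0 < t) :
    ∫⁻ x, g (t • x) = ENNReal.ofReal (t ^ (-(n : ℝ))) * ∫⁻ x, g x := by
  have h1 : MeasurableEmbedding (fun x : E n => t • x) :=
    (Homeomorph.smulOfNeZero t ht.ne').measurableEmbedding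
  rw [← h1.lintegral_map, Measure.map_addHaar_smul volume ht.ne', lintegral_smul_measure]
  simp [finrank_euclideanSpace, abs_of_pos ht, Real.rpow_neg ht.le]

theorem lintegral_dilation_le (hK : IsConicalLocalization K lam) (g : E n → ℝ≥0∞) {t : ℝ}
    (ht : 1 ≤ t) :
    ∫⁻ x in Om K R, ENNReal.ofReal (wt lam P q x) * g (t • x) ≤
      ENNReal.ofReal (t ^ (-(2 * q))) * ∫⁻ x in Om K R, ENNReal.ofReal (wt lam P q x) * g x := by
  have ht0 : 0 < t := by linarith
  have hm : MeasurableSet (Om K R) := hK.isOpen_Om.measurableSet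
  rw [← lintegral_indicator hm, ← lintegral_indicator hm]
  have : ENNReal.ofReal (t ^ (-(2 * q))) =
      ENNReal.ofReal (t ^ (-(2 * q - n))) * ENNReal.ofReal (t ^ (-(n : ℝ))) := by
    rw [← ENNReal.ofReal_mul (by positivity), ← Real.rpow_add ht0]
    ring_nf
  rw [this, mul_assoc, ← lintegral_comp_smul _ ht0, ← lintegral_const_mul' _ _ ENNReal.ofReal_ne_top]
  refine lintegral_mono fun x => ?_
  by_cases hx : x ∈ Om K R
  · rw [indicator_of_mem hx, indicator_of_mem (hK.smul_mem_Om hx ht), wt_smul hK hx.1 ht0,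
      ← mul_assoc, ← ENNReal.ofReal_mul (by positivity), ← mul_assoc, ← Real.rpow_add ht0]
    simp
  · simp [indicator_of_notMem hx]

theorem sq_enorm_sub_le {g g' : ℝ → ℝ} {T : ℝ} (hT : 1 ≤ T)
    (hg : ∀ t ∈ Icc 1 T, HasDerivAt g (g' t) t) (hc : ContinuousOn g' (Icc 1 T)) :
    ‖g T - g 1‖ₑ ^ 2 ≤ ENNReal.ofReal (T - 1) * ∫⁻ t in Icc 1 T, ‖g' t‖ₑ ^ 2 := by
  have hi : IntervalIntegrable g' volume 1 T := by
    apply ContinuousOn.intervalIntegrable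
    rwa [uIcc_of_le hT]
  have h1 : ∫ t in (1:ℝ)..T, g' t = g T - g 1 :=
    intervalIntegral.integral_eq_sub_of_hasDerivAt (by rwa [uIcc_of_le hT]) hi
  rw [← h1, intervalIntegral.integral_of_le hT, ← integral_Icc_eq_integral_Ioc]
  have h2 := eLpNorm_le_eLpNorm_mul_rpow_measure_univ (p := 1) (q := 2) (by norm_num)
    (μ := volume.restrict (Icc 1 T)) (hc.aestronglyMeasurable measurableSet_Icc)
  rw [eLpNorm_one_eq_lintegral_enorm] at h2
  have h3 := (enorm_integral_le_lintegral_enorm _).trans h2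
  have h4 := pow_le_pow_left₀ (by simp) h3 2
  refine h4.trans (le_of_eq ?_)
  rw [mul_pow, eLpNorm_eq_lintegral_rpow_enorm_toReal (by norm_num) (by norm_num), mul_comm]
  simp only [Measure.restrict_apply MeasurableSet.univ, univ_inter, Real.volume_Icc]
  rw [← ENNReal.rpow_natCast, ← ENNReal.rpow_natCast, ← ENNReal.rpow_mul, ← ENNReal.rpow_mul]
  norm_num

theorem sq_eLpNorm_two {α : Type*} [MeasurableSpace α] {μ : Measure α} (g : α → ℝ) :
    eLpNorm g 2 μ ^ 2 = ∫⁻ x, ‖g x‖ₑ ^ 2 ∂μ := by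
  rw [eLpNorm_eq_lintegral_rpow_enorm_toReal (by norm_num) (by norm_num), ← ENNReal.rpow_natCast,
    ← ENNReal.rpow_mul]
  norm_num

theorem theta_eq_sum (f : E n → ℝ) (x : E n) : theta f x = ∑ i, x i * pd i f x := by
  have : x = ∑ i, x i • EuclideanSpace.single i (1 : ℝ) := by
    simpa using ((EuclideanSpace.basisFun (Fin n) ℝ).sum_repr x).symm
  rw [theta]
  nth_rewrite 2 [this]
  simp [pd]

theorem wMeasure_absolutelyContinuous :
    wMeasure K lam P R q ≪ volume.restrict (Om K R) :=
  withDensity_absolutelyContinuous _ _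

theorem ae_wMeasure_mem (hK : IsConicalLocalization K lam) :
    ∀ᵐ x ∂(wMeasure K lam P R q), x ∈ Om K R :=
  wMeasure_absolutelyContinuous.ae_le (ae_restrict_mem hK.isOpen_Om.measurableSet)

theorem aestronglyMeasurable_of_continuousOn (hK : IsConicalLocalization K lam) {g : E n → ℝ}
    (hg : ContinuousOn g (Om K R)) : AEStronglyMeasurable g (wMeasure K lam P R q) :=
  (hg.aestronglyMeasurable hK.isOpen_Om.measurableSet).mono_ac wMeasure_absolutelyContinuous

theorem continuousOn_fderiv_apply {s : Set (E n)} (hs : IsOpen s) {φ : E n → ℝ}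
    (hφ : ContDiffOn ℝ 1 φ s) : ContinuousOn (fderiv ℝ φ) s :=
  hφ.continuousOn_fderiv_of_isOpen hs le_rfl

theorem continuousOn_pd {s : Set (E n)} (hs : IsOpen s) {φ : E n → ℝ}
    (hφ : ContDiffOn ℝ 1 φ s) (i : Fin n) : ContinuousOn (pd i φ) s :=
  (continuousOn_fderiv_apply hs hφ).clm_apply continuousOn_const

theorem lintegral_dilation_sub_le (hK : IsConicalLocalization K lam) {φ : E n → ℝ}
    (hφ : ContDiffOn ℝ 1 φ (Om K R)) (hq : 0 < q) {T : ℝ} (hT : 1 ≤ T) :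
    ∫⁻ x, ‖φ (T • x) - φ x‖ₑ ^ 2 ∂(wMeasure K lam P R q) ≤
      ENNReal.ofReal (T - 1) ^ 2 * ∫⁻ x, ‖theta φ x‖ₑ ^ 2 ∂(wMeasure K lam P R q) := by
  have hO : IsOpen (Om K R) := hK.isOpen_Om
  have hm : MeasurableSet (Om K R) := hO.measurableSet
  have hcf := continuousOn_fderiv_apply hO hφ
  have hmaps : MapsTo (fun z : E n × ℝ => z.2 • z.1) (Om K R ×ˢ Icc 1 T) (Om K R) :=
    fun z hz => hK.smul_mem_Om hz.1 hz.2.1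
  have hcont : ContinuousOn (fun z : E n × ℝ => fderiv ℝ φ (z.2 • z.1) z.1)
      (Om K R ×ˢ Icc 1 T) :=
    (hcf.comp (continuous_snd.smul continuous_fst).continuousOn hmaps).clm_apply
      continuous_fst.continuousOn
  rw [lintegral_wMeasure hK, lintegral_wMeasure hK]
  calc
    _ ≤ ∫⁻ x in Om K R, ENNReal.ofReal (T - 1) * ∫⁻ t in Icc 1 T,
          ENNReal.ofReal (wt lam P q x) * ‖fderiv ℝ φ (t • x) x‖ₑ ^ 2 := by
        refine setLIntegral_mono_ae' hm (ae_of_all _ fun x hx => ?_)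
        rw [lintegral_const_mul' _ _ ENNReal.ofReal_ne_top, mul_left_comm]
        gcongr
        have h := sq_enorm_sub_le (g := fun t => φ (t • x)) (g' := fun t => fderiv ℝ φ (t • x) x)
          hT ?_ ?_
        · simpa using h
        · intro t ht
          have h1 : HasFDerivAt φ (fderiv ℝ φ (t • x)) (t • x) :=
            ((hφ.contDiffAt (hO.mem_nhds (hK.smul_mem_Om hx ht.1))).differentiableAt
              one_ne_zero).hasFDerivAt
          have h2 : HasDerivAt (fun t : ℝ => t • x) x t := by
            simpa using (hasDerivAt_id t).smul_const x
          exact h1.comp_hasDerivAt t h2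
        · exact hcont.comp (f := fun t : ℝ => (x, t)) (by fun_prop) fun t ht => ⟨hx, ht⟩
    _ = ENNReal.ofReal (T - 1) * ∫⁻ t in Icc 1 T, ∫⁻ x in Om K R,
          ENNReal.ofReal (wt lam P q x) * ‖fderiv ℝ φ (t • x) x‖ₑ ^ 2 := by
        rw [lintegral_const_mul' _ _ ENNReal.ofReal_ne_top, lintegral_lintegral_swap]
        rw [Measure.prod_restrict]
        refine AEMeasurable.mul (M := ℝ≥0∞) ?_ ?_
        · refine (ContinuousOn.aemeasurable ?_ (hm.prod measurableSet_Icc)).ennreal_ofReal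
          exact ((contDiffOn_wt hK).continuousOn.mono inter_subset_left).comp
            continuous_fst.continuousOn fun z hz => hz.1
        · exact (hcont.aemeasurable (hm.prod measurableSet_Icc)).enorm.pow_const _
    _ ≤ ENNReal.ofReal (T - 1) * ∫⁻ t in Icc 1 T, ∫⁻ x in Om K R,
          ENNReal.ofReal (wt lam P q x) * ‖theta φ x‖ₑ ^ 2 := by
        gcongr ENNReal.ofReal (T - 1) * ?_
        refine setLIntegral_mono_ae' measurableSet_Icc (ae_of_all _ fun t ht => ?_)
        calc
          _ ≤ ∫⁻ x in Om K R, ENNReal.ofReal (wt lam P q x) * ‖theta φ (t • x)‖ₑ ^ 2 := by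
            gcongr with x
            rw [theta, map_smul, smul_eq_mul, enorm_mul]
            refine le_mul_of_one_le_left (by simp) ?_
            rw [Real.enorm_eq_ofReal (by linarith [ht.1]), ENNReal.one_le_ofReal]
            exact ht.1
          _ ≤ _ := lintegral_dilation_le hK (fun x => ‖theta φ x‖ₑ ^ 2) ht.1
          _ ≤ _ := by
            refine mul_le_of_le_one_left (by simp) ?_
            rw [ENNReal.ofReal_le_one]
            exact Real.rpow_le_one_of_one_le_of_nonpos ht.1 (by linarith)
    _ = _ := by
        rw [lintegral_const, Measure.restrict_apply MeasurableSet.univ, univ_inter,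
          Real.volume_Icc]
        ring

theorem eLpNorm_theta_le (hK : IsConicalLocalization K lam) {φ : E n → ℝ}
    (hφ : ContDiffOn ℝ 1 φ (Om K R)) :
    eLpNorm (theta φ) 2 (wMeasure K lam P R q) ≤
      ∑ i, eLpNorm (pd i φ) 2 (wMeasure K lam P R (q + 1)) := by
  calc
    _ ≤ eLpNorm (fun x => ‖x‖ * ∑ i, ‖pd i φ x‖) 2 (wMeasure K lam P R q) := by
      refine eLpNorm_mono fun x => ?_
      rw [theta_eq_sum, Real.norm_of_nonneg (by positivity : 0 ≤ ‖x‖ * ∑ i, ‖pd i φ x‖),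
        Finset.mul_sum]
      refine norm_sum_le_of_le _ fun i _ => ?_
      rw [norm_mul]
      gcongr
      exact PiLp.norm_apply_le x i
    _ = eLpNorm (∑ i, fun x => ‖pd i φ x‖) 2 (wMeasure K lam P R (q + 1)) := by
      rw [← (ENNReal.pow_right_strictMono two_ne_zero).injective.eq_iff]
      simp only [sq_eLpNorm_two]
      rw [lintegral_wMeasure hK, lintegral_wMeasure hK]
      refine setLIntegral_congr_fun hK.isOpen_Om.measurableSet fun x hx => ?_
      simp only [Finset.sum_apply]
      rw [← norm_sq_mul_wt hK hx.1, ENNReal.ofReal_mul (by positivity), enorm_mul, mul_pow,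
        ENNReal.ofReal_pow (norm_nonneg x), ← Real.enorm_eq_ofReal (norm_nonneg x)]
      ring
    _ ≤ ∑ i, eLpNorm (fun x => ‖pd i φ x‖) 2 (wMeasure K lam P R (q + 1)) := by
      refine eLpNorm_sum_le (fun i _ => ?_) (by norm_num)
      exact (aestronglyMeasurable_of_continuousOn hK (continuousOn_pd hK.isOpen_Om hφ i)).norm
    _ = _ := by simp only [eLpNorm_norm]

/-- Hardy's inequality in the truncated cone. -/
theorem exists_hardy (hK : IsConicalLocalization K lam) (hq : 0 < q) :
    ∃ C : ℝ≥0, ∀ φ : E n → ℝ, ContDiffOn ℝ 1 φ (Om K R) → MemWL2 K lam P R q φ →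
      wNorm K lam P R q φ ≤ C * ∑ i, wNorm K lam P R (q + 1) (pd i φ) := by
  set T : ℝ := 2 ^ (1 / q)
  have hT : 1 ≤ T := Real.one_le_rpow (by norm_num) (by positivity)
  have hTq : T ^ (-(2 * q)) = (1 / 2) ^ 2 := by
    have : 1 / q * -(2 * q) = ((-2 : ℤ) : ℝ) := by
      push_cast
      field_simp
    rw [← Real.rpow_mul (by norm_num), this, Real.rpow_intCast]
    norm_num
  refine ⟨2 * (T - 1).toNNReal, fun φ hφ hmem => ?_⟩
  have hTO : MapsTo (fun x : E n => T • x) (Om K R) (Om K R) := fun x hx => hK.smul_mem_Om hx hT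
  have hc := hφ.continuousOn
  have hcT : ContinuousOn (fun x => φ (T • x)) (Om K R) :=
    hc.comp (continuous_const_smul T).continuousOn hTO
  have h1 : wNorm K lam P R q (fun x => φ (T • x) - φ x) ≤
      ENNReal.ofReal (T - 1) * ∑ i, wNorm K lam P R (q + 1) (pd i φ) := by
    refine le_trans ?_ (mul_le_mul_right (eLpNorm_theta_le hK hφ) _)
    rw [← ENNReal.pow_le_pow_left_iff two_ne_zero, mul_pow, wNorm]
    simpa only [sq_eLpNorm_two] using lintegral_dilation_sub_le hK hφ hq hT
  have h2 : wNorm K lam P R q (fun x => φ (T • x)) ≤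
      ENNReal.ofReal (1 / 2) * wNorm K lam P R q φ := by
    rw [← ENNReal.pow_le_pow_left_iff two_ne_zero, mul_pow, wNorm, wNorm,
      ← ENNReal.ofReal_pow (by norm_num), ← hTq]
    simp only [sq_eLpNorm_two]
    rw [lintegral_wMeasure hK, lintegral_wMeasure hK]
    exact lintegral_dilation_le hK (fun x => ‖φ x‖ₑ ^ 2) hT
  have h3 : wNorm K lam P R q φ ≤ wNorm K lam P R q (fun x => φ (T • x)) +
      wNorm K lam P R q (fun x => φ (T • x) - φ x) := by
    refine le_trans (le_of_eq ?_) (eLpNorm_sub_le (aestronglyMeasurable_of_continuousOn hK hcT)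
      (aestronglyMeasurable_of_continuousOn hK (hcT.sub hc)) (by norm_num))
    congr 1
    ext x
    simp
  have hfin : wNorm K lam P R q φ ≠ ⊤ := hmem.2.ne
  generalize ∑ i, wNorm K lam P R (q + 1) (pd i φ) = B at h1 ⊢
  by_cases hB : B = ⊤
  · rcases hT.eq_or_lt with h | h
    · exact absurd h.symm (Real.one_lt_rpow (by norm_num) (by positivity)).ne'
    · have : (2 * (T - 1).toNNReal : ℝ≥0) ≠ 0 := by simpa using h
      rw [hB, ENNReal.mul_top (by exact ENNReal.coe_ne_zero.2 this)]
      exact le_top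
  have h4 := h3.trans (add_le_add h2 h1)
  lift B to ℝ≥0 using hB
  revert h4
  generalize wNorm K lam P R q φ = A at hfin ⊢
  lift A to ℝ≥0 using hfin
  rw [ENNReal.ofReal, ENNReal.ofReal]
  norm_cast
  intro h4
  rw [← NNReal.coe_le_coe] at h4 ⊢
  push_cast at h4 ⊢
  rw [Real.coe_toNNReal _ (by norm_num)] at h4
  linarith

end LocHam

namespace LocHam

open Set
open scoped NNReal

theorem exists_forall_inner_eq {X Y : Type*} [NormedAddCommGroup X] [NormedSpace ℝ X]
    [CompleteSpace X] [NormedAddCommGroup Y] [InnerProductSpace ℝ Y] [CompleteSpace Y]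
    (A : X →L[ℝ] Y) (C : ℝ≥0) (hA : ∀ x, ‖x‖ ≤ C * ‖A x‖) (l : X →L[ℝ] ℝ) :
    ∃ x, ∀ y, inner ℝ (A x) (A y) = l y := by
  have hanti : AntilipschitzWith C A := ContinuousLinearMap.antilipschitz_of_bound A hA
  have hclosed : IsClosed (LinearMap.range A.toLinearMap : Set Y) := by
    rw [LinearMap.coe_range]
    exact hanti.isClosed_range A.uniformContinuous
  let e := LinearEquiv.ofInjective A.toLinearMap hanti.injective
  have he : ∀ y, A (e.symm y) = y := fun y => by
    exact congrArg Subtype.val (e.apply_symm_apply y)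
  let m : LinearMap.range A.toLinearMap →L[ℝ] ℝ :=
    (l.toLinearMap ∘ₗ e.symm.toLinearMap).mkContinuous (‖l‖ * C) fun y => by
      refine (l.le_opNorm _).trans ?_
      rw [mul_assoc]
      gcongr
      refine (hA _).trans (le_of_eq ?_)
      rw [LinearEquiv.coe_coe, he, Submodule.coe_norm]
  have : CompleteSpace (LinearMap.range A.toLinearMap) := hclosed.completeSpace_coe
  let z := (InnerProductSpace.toDual ℝ _).symm m
  refine ⟨e.symm z, fun y => ?_⟩
  rw [he]
  have h := InnerProductSpace.toDual_symm_apply (𝕜 := ℝ) (x := e y) (y := m)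
  rw [Submodule.coe_inner] at h
  refine Eq.trans ?_ (h.trans ?_)
  · rfl
  · simp [m]

variable {n : ℕ} {K : Set (E n)} {lam : E n → ℝ} {P R q : ℝ}

/-- Functions, gradient fields and Hessian fields in the weighted spaces. -/
abbrev JetSpace (K : Set (E n)) (lam : E n → ℝ) (P R q : ℝ) : Type :=
  Lp ℝ 2 (wMeasure K lam P R q) × (Fin n → Lp ℝ 2 (wMeasure K lam P R (q + 1))) ×
    (Fin n × Fin n → Lp ℝ 2 (wMeasure K lam P R (q + 2)))

/-- Square integrable matrix fields. -/
abbrev MatSpace (K : Set (E n)) (lam : E n → ℝ) (P R q : ℝ) : Type :=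
  PiLp 2 (fun _ : Fin n × Fin n => Lp ℝ 2 (wMeasure K lam P R (q + 2)))

theorem differentiableAt_of_contDiffOn {s : Set (E n)} (hs : IsOpen s) {φ : E n → ℝ}
    {k : WithTop ℕ∞} (hφ : ContDiffOn ℝ k φ s) (hk : 1 ≤ k) {x : E n} (hx : x ∈ s) :
    DifferentiableAt ℝ φ x :=
  (hφ.contDiffAt (hs.mem_nhds hx)).differentiableAt (by positivity)

theorem contDiffOn_pd {s : Set (E n)} (hs : IsOpen s) {φ : E n → ℝ} {k m : WithTop ℕ∞}
    (hφ : ContDiffOn ℝ k φ s) (hk : m + 1 ≤ k) (i : Fin n) : ContDiffOn ℝ m (pd i φ) s :=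
  (hφ.fderiv_of_isOpen hs hk).clm_apply contDiffOn_const

theorem pd_add {f g : E n → ℝ} {x : E n} (hf : DifferentiableAt ℝ f x)
    (hg : DifferentiableAt ℝ g x) (i : Fin n) :
    pd i (fun y => f y + g y) x = pd i f x + pd i g x := by
  simp only [pd]
  rw [fderiv_fun_add hf hg]
  rfl

theorem pd_sub {f g : E n → ℝ} {x : E n} (hf : DifferentiableAt ℝ f x)
    (hg : DifferentiableAt ℝ g x) (i : Fin n) :
    pd i (fun y => f y - g y) x = pd i f x - pd i g x := by
  simp only [pd]
  rw [fderiv_fun_sub hf hg]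
  rfl

theorem pd_mul {f g : E n → ℝ} {x : E n} (hf : DifferentiableAt ℝ f x)
    (hg : DifferentiableAt ℝ g x) (i : Fin n) :
    pd i (fun y => f y * g y) x = f x * pd i g x + g x * pd i f x := by
  simp only [pd]
  rw [fderiv_fun_mul hf hg]
  rfl

theorem pd_const_mul {f : E n → ℝ} {x : E n} (c : ℝ) (i : Fin n) :
    pd i (fun y => c * f y) x = c * pd i f x := by
  rcases eq_or_ne c 0 with rfl | hc
  · simp [pd]
  · let _ := invertibleOfNonzero hc
    change fderiv ℝ (c • f) x _ = _
    rw [fderiv_const_smul_of_invertible]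
    rfl

theorem pd_sum {ι : Type*} {s : Finset ι} {f : ι → E n → ℝ} {x : E n}
    (hf : ∀ k ∈ s, DifferentiableAt ℝ (f k) x) (i : Fin n) :
    pd i (fun y => ∑ k ∈ s, f k y) x = ∑ k ∈ s, pd i (f k) x := by
  simp only [pd]
  rw [fderiv_fun_sum hf]
  simp

theorem pd_congr {f g : E n → ℝ} {x : E n} (h : f =ᶠ[nhds x] g) (i : Fin n) :
    pd i f x = pd i g x := by
  simp only [pd]
  rw [h.fderiv_eq]

theorem pd_congr_of_eqOn {f g : E n → ℝ} {s : Set (E n)} (hs : IsOpen s) {x : E n} (hx : x ∈ s)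
    (h : EqOn f g s) (i : Fin n) : pd i f x = pd i g x :=
  pd_congr (h.eventuallyEq_of_mem (hs.mem_nhds hx)) i

/-- The jets of the smooth functions on `Om K R` with finite norm. -/
noncomputable def smoothJets (hK : IsConicalLocalization K lam) (P R q : ℝ) :
    Submodule ℝ (JetSpace K lam P R q) where
  carrier := {x | ∃ φ : E n → ℝ, ContDiffOn ℝ ∞ φ (Om K R) ∧
    x.1 =ᵐ[wMeasure K lam P R q] φ ∧
    (∀ i, x.2.1 i =ᵐ[wMeasure K lam P R (q + 1)] pd i φ) ∧
    ∀ i j, x.2.2 (i, j) =ᵐ[wMeasure K lam P R (q + 2)] pd i (pd j φ)}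
  add_mem' := by
    rintro x y ⟨φ, hφ, h1, h2, h3⟩ ⟨ψ, hψ, k1, k2, k3⟩
    have hO := hK.isOpen_Om (R := R)
    have e1 : ∀ i, ∀ x ∈ Om K R, pd i (fun y => φ y + ψ y) x = pd i φ x + pd i ψ x :=
      fun i x hx => pd_add (differentiableAt_of_contDiffOn hO hφ (by simp) hx)
        (differentiableAt_of_contDiffOn hO hψ (by simp) hx) i
    refine ⟨fun x => φ x + ψ x, hφ.add hψ, ?_, fun i => ?_, fun i j => ?_⟩
    · filter_upwards [h1, k1, Lp.coeFn_add x.1 y.1] with z h k h'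
      exact h'.trans (by rw [Pi.add_apply, h, k])
    · filter_upwards [h2 i, k2 i, Lp.coeFn_add (x.2.1 i) (y.2.1 i), ae_wMeasure_mem hK]
        with z h k h' hz
      exact h'.trans (by rw [Pi.add_apply, h, k, e1 i z hz])
    · filter_upwards [h3 i j, k3 i j, Lp.coeFn_add (x.2.2 (i, j)) (y.2.2 (i, j)),
        ae_wMeasure_mem hK] with z h k h' hz
      rw [pd_congr_of_eqOn hO hz (e1 j), pd_add (differentiableAt_of_contDiffOn hO
        (contDiffOn_pd hO hφ (m := 1) (by norm_cast) j) le_rfl hz) (differentiableAt_of_contDiffOn hO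
        (contDiffOn_pd hO hψ (m := 1) (by norm_cast) j) le_rfl hz)]
      exact h'.trans (by rw [Pi.add_apply, h, k])
  zero_mem' := by
    refine ⟨fun _ => 0, contDiffOn_const, Lp.coeFn_zero _ _ _, fun i => ?_, fun i j => ?_⟩
    · filter_upwards [Lp.coeFn_zero ℝ 2 (wMeasure K lam P R (q + 1))] with z h
      exact h.trans (by simp [pd])
    · filter_upwards [Lp.coeFn_zero ℝ 2 (wMeasure K lam P R (q + 2))] with z h
      have : pd j (fun _ : E n => (0 : ℝ)) = fun _ => 0 := by
        ext; simp [pd]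
      rw [this]
      exact h.trans (by simp [pd])
  smul_mem' := by
    rintro c x ⟨φ, hφ, h1, h2, h3⟩
    refine ⟨fun x => c * φ x, contDiffOn_const.mul hφ, ?_, fun i => ?_, fun i j => ?_⟩
    · filter_upwards [h1, Lp.coeFn_smul c x.1] with z h h'
      exact h'.trans (by rw [Pi.smul_apply, h, smul_eq_mul])
    · filter_upwards [h2 i, Lp.coeFn_smul c (x.2.1 i)] with z h h'
      exact h'.trans (by rw [Pi.smul_apply, h, smul_eq_mul, pd_const_mul])
    · filter_upwards [h3 i j, Lp.coeFn_smul c (x.2.2 (i, j))] with z h h'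
      have : pd j (fun x => c * φ x) = fun x => c * pd j φ x := by
        ext; rw [pd_const_mul]
      rw [this, pd_const_mul]
      exact h'.trans (by rw [Pi.smul_apply, h, smul_eq_mul])

/-- The matrix field `∂_i ∂_j u - δ_{ij} Δ u` of a jet. -/
noncomputable def adjMap (K : Set (E n)) (lam : E n → ℝ) (P R q : ℝ) :
    JetSpace K lam P R q →L[ℝ] MatSpace K lam P R q :=
  (PiLp.continuousLinearEquiv 2 ℝ
    (fun _ : Fin n × Fin n => Lp ℝ 2 (wMeasure K lam P R (q + 2)))).symm.toContinuousLinearMap ∘L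
  (ContinuousLinearMap.pi fun ij : Fin n × Fin n =>
    ContinuousLinearMap.proj ij - if ij.1 = ij.2 then ∑ k : Fin n,
      ContinuousLinearMap.proj (R := ℝ)
        (φ := fun _ : Fin n × Fin n => Lp ℝ 2 (wMeasure K lam P R (q + 2))) (k, k) else 0) ∘L
  ContinuousLinearMap.snd ℝ _ _ ∘L ContinuousLinearMap.snd ℝ _ _

theorem adjMap_apply (x : JetSpace K lam P R q) (i j : Fin n) :
    adjMap K lam P R q x (i, j) = x.2.2 (i, j) - if i = j then ∑ k, x.2.2 (k, k) else 0 := by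
  simp only [adjMap]
  split_ifs with h <;> simp [h]

theorem norm_hess_le (hn : 3 ≤ n) (x : JetSpace K lam P R q) (ij : Fin n × Fin n) :
    ‖x.2.2 ij‖ ≤ (n + 1) * ‖adjMap K lam P R q x‖ := by
  obtain ⟨i, j⟩ := ij
  set t := ∑ k, x.2.2 (k, k)
  have h0 : ∀ ij, ‖adjMap K lam P R q x ij‖ ≤ ‖adjMap K lam P R q x‖ :=
    fun ij => PiLp.norm_apply_le _ ij
  have hn' : (2 : ℝ) ≤ (n : ℝ) - 1 := by
    have : (3 : ℝ) ≤ n := by exact_mod_cast hn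
    linarith
  have ht : ∑ k, adjMap K lam P R q x (k, k) = (-((n : ℝ) - 1)) • t := by
    simp only [adjMap_apply, if_true, Finset.sum_sub_distrib]
    simp only [Finset.sum_const, Finset.card_univ, Fintype.card_fin]
    change t - n • t = _
    rw [← Nat.cast_smul_eq_nsmul ℝ n t]
    module
  have h1 : ‖t‖ ≤ n * ‖adjMap K lam P R q x‖ := by
    have h2 : ‖(-((n : ℝ) - 1)) • t‖ ≤ n * ‖adjMap K lam P R q x‖ := by
      rw [← ht]
      refine (norm_sum_le_of_le _ fun k _ => h0 (k, k)).trans ?_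
      simp
    rw [norm_smul, norm_neg, Real.norm_of_nonneg (by linarith)] at h2
    nlinarith [norm_nonneg t]
  have h3 : x.2.2 (i, j) = adjMap K lam P R q x (i, j) + if i = j then t else 0 := by
    rw [adjMap_apply]
    simp [t]
  rw [h3]
  refine (norm_add_le _ _).trans ?_
  have h4 := h0 (i, j)
  split_ifs
  · linarith
  · rw [norm_zero]
    nlinarith [norm_nonneg (adjMap K lam P R q x)]

theorem exists_norm_le_of_mem_closure (hK : IsConicalLocalization K lam) (hn : 3 ≤ n)
    (hq : 0 < q) : ∃ C : ℝ≥0, ∀ x ∈ (smoothJets hK P R q).topologicalClosure,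
      ‖x‖ ≤ C * ‖adjMap K lam P R q x‖ := by
  obtain ⟨C0, hC0⟩ := exists_hardy hK (P := P) (R := R) hq
  obtain ⟨C1, hC1⟩ := exists_hardy hK (P := P) (R := R) (by linarith : 0 < q + 1)
  have hO := hK.isOpen_Om (R := R)
  have key : ∀ x ∈ smoothJets hK P R q, ‖x.1‖ ≤ C0 * ∑ i, ‖x.2.1 i‖ ∧
      ∀ i, ‖x.2.1 i‖ ≤ C1 * ∑ j, ‖x.2.2 (j, i)‖ := by
    rintro x ⟨φ, hφ, h1, h2, h3⟩
    have aux : ∀ {m : Measure (E n)} (f : Lp ℝ 2 m) {g : E n → ℝ}, f =ᵐ[m] g →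
        eLpNorm g 2 m = ENNReal.ofReal ‖f‖ := fun f g hfg => by
      rw [← eLpNorm_congr_ae hfg, Lp.norm_def, ENNReal.ofReal_toReal (Lp.eLpNorm_ne_top f)]
    constructor
    · have h := hC0 φ (hφ.of_le (by simp)) ((memLp_congr_ae h1).1 (Lp.memLp _))
      simp only [wNorm] at h
      rw [aux _ h1] at h
      simp_rw [aux _ (h2 _)] at h
      rw [← ENNReal.ofReal_sum_of_nonneg (by simp), ← ENNReal.ofReal_coe_nnreal,
        ← ENNReal.ofReal_mul (by simp), ENNReal.ofReal_le_ofReal_iff (by positivity)] at h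
      exact h
    · intro i
      have h := hC1 (pd i φ) (contDiffOn_pd hO hφ (by norm_cast) i)
        ((memLp_congr_ae (h2 i)).1 (Lp.memLp _))
      have e : q + 1 + 1 = q + 2 := by ring
      rw [e] at h
      simp only [wNorm] at h
      rw [aux _ (h2 i)] at h
      simp_rw [aux _ (h3 _ i)] at h
      rw [← ENNReal.ofReal_sum_of_nonneg (by simp), ← ENNReal.ofReal_coe_nnreal,
        ← ENNReal.ofReal_mul (by simp), ENNReal.ofReal_le_ofReal_iff (by positivity)] at h
      exact h
  have key2 : ∀ x ∈ (smoothJets hK P R q).topologicalClosure, ‖x.1‖ ≤ C0 * ∑ i, ‖x.2.1 i‖ ∧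
      ∀ i, ‖x.2.1 i‖ ≤ C1 * ∑ j, ‖x.2.2 (j, i)‖ := by
    intro x hx
    have hc : IsClosed {x : JetSpace K lam P R q | ‖x.1‖ ≤ C0 * ∑ i, ‖x.2.1 i‖ ∧
      ∀ i, ‖x.2.1 i‖ ≤ C1 * ∑ j, ‖x.2.2 (j, i)‖} := by
      simp only [ofPred_and, ofPred_forall]
      refine IsClosed.inter (isClosed_le (by fun_prop) (by fun_prop)) (isClosed_iInter fun i => ?_)
      exact isClosed_le (by fun_prop) (by fun_prop)
    exact closure_minimal (fun y hy => key y hy) hc hx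
  refine ⟨(n + 1) + C1 * (n * (n + 1)) + C0 * (n * (C1 * (n * (n + 1)))), fun x hx => ?_⟩
  obtain ⟨k0, k1⟩ := key2 x hx
  have k2 := norm_hess_le hn x
  set a := ‖adjMap K lam P R q x‖
  have ha : 0 ≤ a := norm_nonneg _
  have k1' : ∀ i, ‖x.2.1 i‖ ≤ C1 * (n * ((n + 1) * a)) := fun i => by
    refine (k1 i).trans ?_
    gcongr
    refine (Finset.sum_le_sum fun j _ => k2 (j, i)).trans (by simp)
  have k0' : ‖x.1‖ ≤ C0 * (n * (C1 * (n * ((n + 1) * a)))) := by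
    refine k0.trans ?_
    gcongr
    refine (Finset.sum_le_sum fun j _ => k1' j).trans (by simp)
  have p0 : 0 ≤ (n + 1) * a := by positivity
  have p1 : 0 ≤ C1 * (n * ((n + 1) * a)) := by positivity
  have p2 : 0 ≤ C0 * (n * (C1 * (n * ((n + 1) * a)))) := by positivity
  have e : ((((n + 1) + C1 * (n * (n + 1)) + C0 * (n * (C1 * (n * (n + 1)))) : ℝ≥0)) : ℝ) * a =
    (n + 1) * a + C1 * (n * ((n + 1) * a)) + C0 * (n * (C1 * (n * ((n + 1) * a)))) := by
    push_cast
    ring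
  rw [e, Prod.norm_def, Prod.norm_def]
  refine max_le (by linarith) (max_le ?_ ?_)
  · refine (pi_norm_le_iff_of_nonneg (by linarith)).2 fun i => ?_
    linarith [k1' i]
  · refine (pi_norm_le_iff_of_nonneg (by linarith)).2 fun ij => ?_
    linarith [k2 ij]

end LocHam

namespace LocHam

open Set
open scoped NNReal

variable {n : ℕ} {K : Set (E n)} {lam : E n → ℝ} {P R q : ℝ} {u : E n → ℝ}
  {G : Fin n → E n → ℝ} {D : Fin n → Fin n → E n → ℝ}

/-- The jet of an element of `H²`. -/
noncomputable def IsH2With.jet (h : IsH2With K lam P R q u G D) : JetSpace K lam P R q :=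
  (h.mem.toLp u, fun i => (h.mem_grad i).toLp (G i),
    fun ij => (h.mem_hess ij.1 ij.2).toLp (D ij.1 ij.2))

theorem memLp_of_eLpNorm_sub_lt {α : Type*} [MeasurableSpace α] {μ : Measure α} {f g : α → ℝ}
    {ε : ℝ≥0∞} (hf : MemLp f 2 μ) (hg : AEStronglyMeasurable g μ)
    (h : eLpNorm (fun x => f x - g x) 2 μ < ε) : MemLp g 2 μ := by
  have : MemLp (fun x => f x - g x) 2 μ := ⟨hf.1.sub hg, h.trans_le le_top⟩
  have h' := hf.sub this
  rwa [show (f - fun x => f x - g x) = g by ext; simp] at h'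

theorem IsH2With.jet_hess (h : IsH2With K lam P R q u G D) (i j : Fin n) :
    h.jet.2.2 (i, j) =ᵐ[wMeasure K lam P R (q + 2)] D i j :=
  (h.mem_hess i j).coeFn_toLp

theorem edist_pi_lt_iff_forall {ι : Type*} [Fintype ι] {π : ι → Type*}
    [∀ i, PseudoEMetricSpace (π i)] {f g : ∀ i, π i} {r : ℝ≥0∞} (hr : 0 < r) :
    edist f g < r ↔ ∀ i, edist (f i) (g i) < r := by
  rw [edist_pi_def, Finset.sup_lt_iff hr]
  simp

theorem restrict_absolutelyContinuous_wMeasure (hK : IsConicalLocalization K lam) :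
    (volume.restrict (Om K R)) ≪ wMeasure K lam P R q := by
  refine withDensity_absolutelyContinuous' (aemeasurable_wt hK).ennreal_ofReal ?_
  filter_upwards [ae_restrict_mem hK.isOpen_Om.measurableSet] with x hx
  exact (ENNReal.ofReal_pos.2 (wt_pos hK hx.1)).ne'

theorem IsH2With.jet_mem (hK : IsConicalLocalization K lam) (h : IsH2With K lam P R q u G D) :
    h.jet ∈ (smoothJets hK P R q).topologicalClosure := by
  have hO := hK.isOpen_Om (R := R)
  refine EMetric.mem_closure_iff.2 fun ε hε => ?_
  obtain ⟨φ, hφ, h0, h1, h2⟩ := h.approx ε hε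
  have m0 : MemLp φ 2 (wMeasure K lam P R q) := memLp_of_eLpNorm_sub_lt h.mem
    (aestronglyMeasurable_of_continuousOn hK hφ.continuousOn) h0
  have m1 : ∀ i, MemLp (pd i φ) 2 (wMeasure K lam P R (q + 1)) := fun i =>
    memLp_of_eLpNorm_sub_lt (h.mem_grad i) (aestronglyMeasurable_of_continuousOn hK
      (continuousOn_pd hO (hφ.of_le (by simp)) i)) (h1 i)
  have m2 : ∀ i j, MemLp (pd i (pd j φ)) 2 (wMeasure K lam P R (q + 2)) := fun i j =>
    memLp_of_eLpNorm_sub_lt (h.mem_hess i j) (aestronglyMeasurable_of_continuousOn hK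
      (continuousOn_pd hO (contDiffOn_pd hO hφ (by norm_cast) j) i)) (h2 i j)
  refine ⟨(m0.toLp φ, fun i => (m1 i).toLp _, fun ij => (m2 ij.1 ij.2).toLp _),
    ⟨φ, hφ, m0.coeFn_toLp, fun i => (m1 i).coeFn_toLp, fun i j => (m2 i j).coeFn_toLp⟩, ?_⟩
  rw [Prod.edist_eq, Prod.edist_eq, max_lt_iff, max_lt_iff, edist_pi_lt_iff_forall hε, edist_pi_lt_iff_forall hε]
  exact ⟨(Lp.edist_toLp_toLp _ _ h.mem m0).trans_lt h0,
    fun i => (Lp.edist_toLp_toLp _ _ (h.mem_grad i) (m1 i)).trans_lt (h1 i),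
    fun ij => (Lp.edist_toLp_toLp _ _ (h.mem_hess ij.1 ij.2) (m2 ij.1 ij.2)).trans_lt
      (h2 ij.1 ij.2)⟩

theorem isH2With_of_mem (hK : IsConicalLocalization K lam) {x : JetSpace K lam P R q}
    (hx : x ∈ (smoothJets hK P R q).topologicalClosure) :
    IsH2With K lam P R q x.1 (fun i => x.2.1 i) (fun i j => x.2.2 (i, j)) := by
  refine ⟨Lp.memLp _, fun i => Lp.memLp _, fun i j => Lp.memLp _, fun ε hε => ?_⟩
  obtain ⟨y, ⟨φ, hφ, h0, h1, h2⟩, hy⟩ := EMetric.mem_closure_iff.1 hx ε hε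
  rw [Prod.edist_eq, Prod.edist_eq, max_lt_iff, max_lt_iff, edist_pi_lt_iff_forall hε,
    edist_pi_lt_iff_forall hε] at hy
  simp only [Lp.edist_def] at hy
  refine ⟨φ, hφ, (eLpNorm_congr_ae ?_).trans_lt hy.1, fun i =>
    (eLpNorm_congr_ae ?_).trans_lt (hy.2.1 i), fun i j =>
    (eLpNorm_congr_ae ?_).trans_lt (hy.2.2 (i, j))⟩
  · filter_upwards [h0] with z hz
    simp [hz]
  · filter_upwards [h1 i] with z hz
    simp [hz]
  · filter_upwards [h2 i j] with z hz
    simp [hz]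

theorem integral_wMeasure (hK : IsConicalLocalization K lam) (g : E n → ℝ) :
    ∫ x, g x ∂(wMeasure K lam P R q) = ∫ x in Om K R, wt lam P q x * g x := by
  have hm : MeasurableSet (Om K R) := hK.isOpen_Om.measurableSet
  rw [wMeasure_eq, integral_withDensity_eq_integral_toReal_smul₀
    (aemeasurable_wt hK).ennreal_ofReal (by simp)]
  refine setIntegral_congr_fun hm fun x hx => ?_
  simp [ENNReal.toReal_ofReal (wt_pos hK hx.1).le]

theorem pow_mul_wt (hK : IsConicalLocalization K lam) {x : E n} (hx : x ∈ K) (k : ℕ) :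
    ‖x‖ ^ (2 * k) * wt lam P q x = wt lam P (q + k) x := by
  rw [wt, wt, ← mul_assoc, ← Real.rpow_natCast, ← Real.rpow_add (norm_pos_iff.2 (hK.ne_zero hx))]
  congr 2
  push_cast
  ring

theorem memWL2_norm_pow_mul (hK : IsConicalLocalization K lam) {f : E n → ℝ} (k : ℕ)
    (hf : MemWL2 K lam P R (q + k) f) : MemWL2 K lam P R q (fun x => ‖x‖ ^ k * f x) := by
  have hm : MeasurableSet (Om K R) := hK.isOpen_Om.measurableSet
  constructor
  · refine AEStronglyMeasurable.mul (by fun_prop) ?_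
    exact (hf.1.mono_ac (restrict_absolutelyContinuous_wMeasure hK)).mono_ac wMeasure_absolutelyContinuous
  · have h : eLpNorm (fun x => ‖x‖ ^ k * f x) 2 (wMeasure K lam P R q) =
        eLpNorm f 2 (wMeasure K lam P R (q + k)) := by
      rw [← (ENNReal.pow_right_strictMono two_ne_zero).injective.eq_iff]
      simp only [sq_eLpNorm_two]
      rw [lintegral_wMeasure hK, lintegral_wMeasure hK]
      refine setLIntegral_congr_fun hm fun x hx => ?_
      rw [← pow_mul_wt hK hx.1, ENNReal.ofReal_mul (by positivity), enorm_mul, mul_pow,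
        ENNReal.ofReal_pow (norm_nonneg x), enorm_pow, ← pow_mul, mul_comm k 2, enorm_norm,
        ofReal_norm]
      ring
    rw [h]
    exact hf.2

theorem omega_sq (hK : IsConicalLocalization K lam) {p : ℝ} {x : E n} (hx : x ∈ K) :
    omega lam P p x ^ 2 = wt lam P (n - p) x := by
  rw [omega, wt, mul_pow, ← Real.rpow_natCast, ← Real.rpow_natCast,
    ← Real.rpow_mul (norm_nonneg x), ← Real.rpow_mul (hK.pos x hx).le]
  congr 2 <;> push_cast <;> ring

theorem inner_adjMap (hK : IsConicalLocalization K lam) {p : ℝ} (hpq : q = n - p - 2)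
    {D' : Fin n → Fin n → E n → ℝ}
    (x x' : JetSpace K lam P R q)
    (hx : ∀ i j, x.2.2 (i, j) =ᵐ[wMeasure K lam P R (q + 2)] D i j)
    (hx' : ∀ i j, x'.2.2 (i, j) =ᵐ[wMeasure K lam P R (q + 2)] D' i j) :
    inner ℝ (adjMap K lam P R q x) (adjMap K lam P R q x') =
      ∫ x in Om K R, (∑ i, ∑ j, adjH D' i j x * adjH D i j x) * omega lam P p x ^ 2 := by
  have hm : MeasurableSet (Om K R) := hK.isOpen_Om.measurableSet
  have key : ∀ (y : JetSpace K lam P R q) (F : Fin n → Fin n → E n → ℝ),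
      (∀ i j, y.2.2 (i, j) =ᵐ[wMeasure K lam P R (q + 2)] F i j) → ∀ i j,
      adjMap K lam P R q y (i, j) =ᵐ[wMeasure K lam P R (q + 2)] adjH F i j := by
    intro y F hF i j
    rw [adjMap_apply]
    by_cases h : i = j
    · simp only [if_pos h]
      filter_upwards [Lp.coeFn_sub (y.2.2 (i, j)) (∑ k, y.2.2 (k, k)),
        Lp.coeFn_finsetSum (Finset.univ) (fun k => y.2.2 (k, k)), hF i j,
        ae_all_iff.2 fun k => hF k k] with z h1 h2 h3 h4
      rw [h1, Pi.sub_apply, h2, h3]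
      simp [adjH, if_pos h, h4]
    · simp only [if_neg h, sub_zero]
      filter_upwards [hF i j] with z hz
      simp [adjH, if_neg h, hz]
  rw [PiLp.inner_apply]
  simp only [L2.inner_def]
  rw [← integral_finsetSum _ fun ij _ => L2.integrable_inner _ _, Eq.comm]
  calc
    _ = ∫ x, ∑ i, ∑ j, adjH D' i j x * adjH D i j x ∂(wMeasure K lam P R (q + 2)) := by
      rw [integral_wMeasure hK]
      refine setIntegral_congr_fun hm fun x hx => ?_
      rw [omega_sq hK hx.1, hpq, mul_comm]
      congr 2
      ring
    _ = _ := by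
      refine integral_congr_ae ?_
      filter_upwards [ae_all_iff.2 fun i => ae_all_iff.2 fun j => key x D hx i j,
        ae_all_iff.2 fun i => ae_all_iff.2 fun j => key x' D' hx' i j] with z h1 h2
      rw [Fintype.sum_prod_type]
      simp only [h1, h2]
      rfl

theorem integral_source (hK : IsConicalLocalization K lam) {p : ℝ} (hpq : q = n - p - 2)
    {f w : E n → ℝ} : ∫ x, (‖x‖ ^ 4 * f x) * w x ∂(wMeasure K lam P R q) =
      ∫ x in Om K R, w x * f x * omega lam P p x ^ 2 := by
  rw [integral_wMeasure hK]
  refine setIntegral_congr_fun hK.isOpen_Om.measurableSet fun x hx => ?_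
  have h := pow_mul_wt (P := P) (q := q) hK hx.1 2
  have e : q + (2 : ℕ) = n - p := by rw [hpq]; push_cast; ring
  rw [e] at h
  rw [omega_sq hK hx.1, ← h]
  ring

theorem isVariationalSolution_of_inner (hK : IsConicalLocalization K lam) {p : ℝ}
    (hpq : q = n - p - 2) {f : E n → ℝ} {x : JetSpace K lam P R q} 
    (hx : x ∈ (smoothJets hK P R q).topologicalClosure)
    (h : ∀ y ∈ (smoothJets hK P R q).topologicalClosure,
      inner ℝ (adjMap K lam P R q x) (adjMap K lam P R q y) =
        ∫ z, (‖z‖ ^ 4 * f z) * y.1 z ∂(wMeasure K lam P R q)) :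
    IsVariationalSolution K lam P R p f x.1 := by
  subst hpq
  refine ⟨_, _, isH2With_of_mem hK hx, fun w G' D' hw => ?_⟩
  have h' := h hw.jet (hw.jet_mem hK)
  rw [inner_adjMap hK rfl x hw.jet (fun i j => Filter.EventuallyEq.rfl)
    hw.jet_hess] at h'
  rw [h', ← integral_source hK rfl]
  refine integral_congr_ae ?_
  filter_upwards [hw.mem.coeFn_toLp] with z hz
  rw [← hz]
  rfl

theorem exists_variationalSolution (hK : IsConicalLocalization K lam) (hn : 3 ≤ n) {p : ℝ}
    (hp : p < n - 2) {f : E n → ℝ} (hf : MemWL2 K lam P R (n - p + 2) f) :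
    ∃ u : E n → ℝ, IsVariationalSolution K lam P R p f u := by
  have hq : 0 < n - p - 2 := by linarith
  obtain ⟨C, hC⟩ := exists_norm_le_of_mem_closure hK (P := P) (R := R) hn hq
  have hF : MemWL2 K lam P R (n - p - 2) (fun x => ‖x‖ ^ 4 * f x) := by
    refine memWL2_norm_pow_mul hK 4 ?_
    convert hf using 1
    push_cast
    ring
  set H := (smoothJets hK P R (n - p - 2)).topologicalClosure
  have : CompleteSpace H := (Submodule.isClosed_topologicalClosure _).completeSpace_coe
  obtain ⟨x, hx⟩ := exists_forall_inner_eq (adjMap K lam P R (n - p - 2) ∘L H.subtypeL) C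
    (fun x => hC x x.2) (innerSL ℝ (hF.toLp _) ∘L ContinuousLinearMap.fst ℝ _ _ ∘L H.subtypeL)
  refine ⟨_, isVariationalSolution_of_inner hK rfl x.2 fun y hy => ?_⟩
  refine (hx ⟨y, hy⟩).trans ?_
  simp only [ContinuousLinearMap.comp_apply, innerSL_apply_apply, L2.inner_def]
  refine integral_congr_ae ?_
  filter_upwards [hF.coeFn_toLp] with z hz
  rw [hz]
  simp [mul_comm]

theorem variationalSolution_unique (hK : IsConicalLocalization K lam) (hn : 3 ≤ n) {p : ℝ}
    (hp : p < n - 2) {f u v : E n → ℝ} (hu : IsVariationalSolution K lam P R p f u)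
    (hv : IsVariationalSolution K lam P R p f v) : v =ᵐ[volume.restrict (Om K R)] u := by
  have hq : 0 < n - p - 2 := by linarith
  obtain ⟨C, hC⟩ := exists_norm_le_of_mem_closure hK (P := P) (R := R) hn hq
  obtain ⟨G, D, h, hu⟩ := hu
  obtain ⟨G', D', h', hv⟩ := hv
  have key : ∀ y ∈ (smoothJets hK P R (n - p - 2)).topologicalClosure,
      inner ℝ (adjMap K lam P R _ (h.jet - h'.jet)) (adjMap K lam P R _ y) = 0 := fun y hy => by
    have hy' := isH2With_of_mem hK hy
    rw [map_sub, inner_sub_left, inner_adjMap hK rfl h.jet y h.jet_hess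
      (fun i j => Filter.EventuallyEq.rfl), inner_adjMap hK rfl h'.jet y
      h'.jet_hess (fun i j => Filter.EventuallyEq.rfl), hu _ _ _ hy',
      hv _ _ _ hy', sub_self]
  have hmem := Submodule.sub_mem _ (h.jet_mem hK) (h'.jet_mem hK)
  have h0 := key _ hmem
  rw [inner_self_eq_zero] at h0
  have h1 := hC _ hmem
  rw [h0, norm_zero, mul_zero] at h1
  have h2 := sub_eq_zero.1 (norm_le_zero_iff.1 h1)
  have h3 : u =ᵐ[wMeasure K lam P R (n - p - 2)] v :=
    (MemLp.toLp_eq_toLp_iff h.mem h'.mem).1 (congrArg Prod.fst h2)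
  exact Filter.EventuallyEq.symm ((restrict_absolutelyContinuous_wMeasure hK).ae_le h3)

end LocHam

namespace LocHam

open Set
open scoped NNReal

variable {n : ℕ} {k : WithTop ℕ∞} {O : Set (E n)} {f g : E n → ℝ} {R : ℝ}

/-- `g` is a test function of class `C^k` on `O`: it is `C^k` on the whole space and its support
is a compact subset of `O`. -/
structure IsTest (k : WithTop ℕ∞) (O : Set (E n)) (g : E n → ℝ) : Prop where
  contDiff : ContDiff ℝ k g
  compact : HasCompactSupport g
  subset : tsupport g ⊆ O

namespace IsTest

theorem mono {m : WithTop ℕ∞} {O' : Set (E n)} (h : IsTest k O g) (hm : m ≤ k) (hO : O ⊆ O') :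
    IsTest m O' g :=
  ⟨h.contDiff.of_le hm, h.compact, h.subset.trans hO⟩

theorem eq_zero (h : IsTest k O g) {x : E n} (hx : x ∉ O) : g x = 0 :=
  image_eq_zero_of_notMem_tsupport fun h' => hx (h.subset h')

theorem mul_left {a : E n → ℝ} (h : IsTest k O g) (hO : IsOpen O) (ha : ContDiffOn ℝ k a O) :
    IsTest k O (fun x => a x * g x) := by
  have hs : tsupport (fun x => a x * g x) ⊆ tsupport g := tsupport_mul_subset_right
  refine ⟨contDiff_iff_contDiffAt.2 fun x => ?_, h.compact.mul_left, hs.trans h.subset⟩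
  by_cases hx : x ∈ tsupport fun x => a x * g x
  · exact (ha.contDiffAt (hO.mem_nhds (h.subset (hs hx)))).mul h.contDiff.contDiffAt
  · exact contDiffAt_const.congr_of_eventuallyEq (notMem_tsupport_iff_eventuallyEq.1 hx)

theorem add (h : IsTest k O g) (hf : IsTest k O f) : IsTest k O (fun x => g x + f x) :=
  ⟨h.contDiff.add hf.contDiff, h.compact.add hf.compact,
    (tsupport_add g f).trans (union_subset h.subset hf.subset)⟩

theorem const_mul (h : IsTest k O g) (c : ℝ) : IsTest k O (fun x => c * g x) :=
  ⟨contDiff_const.mul h.contDiff, h.compact.mul_left,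
    (tsupport_mul_subset_right (f := fun _ => c)).trans h.subset⟩

theorem sub (h : IsTest k O g) (hf : IsTest k O f) : IsTest k O (fun x => g x - f x) := by
  simpa [sub_eq_add_neg] using h.add (hf.const_mul (-1))

theorem zero : IsTest k O (fun _ => 0) :=
  ⟨contDiff_const, HasCompactSupport.zero, by simp [tsupport]⟩

theorem sum {ι : Type*} (s : Finset ι) {F : ι → E n → ℝ} (h : ∀ i ∈ s, IsTest k O (F i)) :
    IsTest k O (fun x => ∑ i ∈ s, F i x) := by
  classical
  induction s using Finset.induction_on with
  | empty => simpa using zero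
  | insert i s hi ih =>
    simp only [Finset.sum_insert hi]
    exact (h i (Finset.mem_insert_self i s)).add
      (ih fun j hj => h j (Finset.mem_insert_of_mem hj))

theorem pderiv {m : WithTop ℕ∞} (h : IsTest k O g) (hm : m + 1 ≤ k) (i : Fin n) :
    IsTest m O (pd i g) := by
  refine ⟨(h.contDiff.fderiv_right hm).clm_apply contDiff_const, h.compact.fderiv_apply ℝ _, ?_⟩
  exact (tsupport_fderiv_apply_subset ℝ _).trans h.subset

theorem integrable (h : IsTest k O g) : Integrable g :=
  h.contDiff.continuous.integrable_of_hasCompactSupport h.compact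

theorem differentiableAt (h : IsTest k O g) (hk : 1 ≤ k) (x : E n) : DifferentiableAt ℝ g x :=
  (h.contDiff.contDiffAt).differentiableAt (by positivity)

theorem integral_pd_eq_zero (h : IsTest k O g) (hk : 1 ≤ k) (i : Fin n) :
    ∫ x, pd i g x = 0 := by
  have h1 := integral_mul_fderiv_eq_neg_fderiv_mul_of_integrable (μ := volume) (f := fun _ => (1 : ℝ))
    (g := g) (v := EuclideanSpace.single i 1) (by simp)
    (by simp only [one_mul]; exact (h.pderiv (m := 0) (by simpa using hk) i).integrable) (by simpa using h.integrable)
    (by simp) (fun x _ => h.differentiableAt hk x)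
  simpa [pd] using h1

end IsTest

theorem pd_coord (i j : Fin n) (x : E n) : pd i (fun y => y j) x = if i = j then 1 else 0 := by
  have : fderiv ℝ (fun y : E n => y j) x = EuclideanSpace.proj j :=
    (EuclideanSpace.proj (𝕜 := ℝ) j).hasFDerivAt.fderiv
  rw [pd, this]
  simp [eq_comm]

theorem contDiff_coord {k : WithTop ℕ∞} (j : Fin n) : ContDiff ℝ k (fun y : E n => y j) :=
  (EuclideanSpace.proj (𝕜 := ℝ) j).contDiff

theorem differentiableAt_coord (j : Fin n) (x : E n) : DifferentiableAt ℝ (fun y : E n => y j) x :=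
  (contDiff_coord (k := 1) j).contDiffAt.differentiableAt one_ne_zero

theorem pd_norm_sq (i : Fin n) (x : E n) : pd i (fun y => ‖y‖ ^ 2) x = 2 * x i := by
  have : HasFDerivAt (fun y : E n => ‖y‖ ^ 2) (2 • innerSL ℝ x) x :=
    (hasStrictFDerivAt_norm_sq x).hasFDerivAt
  rw [pd, this.fderiv]
  simp [EuclideanSpace.inner_single_right]

/-- The integral of a rotation derivative over the complement of a ball vanishes. -/
theorem IsTest.setIntegral_rot_eq_zero (h : IsTest 1 O g) (R : ℝ) (hR : 0 < R) (i j : Fin n) :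
    ∫ x in {x : E n | R < ‖x‖}, (x j * pd i g x - x i * pd j g x) = 0 := by
  have hm : MeasurableSet {x : E n | R < ‖x‖} := (isOpen_lt continuous_const continuous_norm).measurableSet
  let χ : ℕ → E n → ℝ := fun k x => Real.smoothTransition (k * (‖x‖ ^ 2 - R ^ 2))
  have hχ : ∀ k, ContDiff ℝ 1 (χ k) := fun k =>
    Real.smoothTransition.contDiff.comp (contDiff_const.mul ((contDiff_norm_sq ℝ).sub contDiff_const))
  have hpχ : ∀ k i x, pd i (χ k) x = deriv Real.smoothTransition (k * (‖x‖ ^ 2 - R ^ 2)) * (k * (2 * x i)) := by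
    intro k i x
    have h1 : HasFDerivAt (fun y : E n => ‖y‖ ^ 2) (2 • innerSL ℝ x) x :=
      (hasStrictFDerivAt_norm_sq x).hasFDerivAt
    have h2 := ((Real.smoothTransition.contDiff (n := 1)).contDiffAt
      (x := k * (‖x‖ ^ 2 - R ^ 2))).differentiableAt one_ne_zero |>.hasDerivAt
    have h3 := h2.comp_hasFDerivAt x ((h1.sub_const (R ^ 2)).const_mul (k : ℝ))
    have h4 : fderiv ℝ (χ k) x = _ := h3.fderiv
    rw [pd, h4]
    simp [EuclideanSpace.inner_single_right]
  have hzero : ∀ k, ∫ x, χ k x * (x j * pd i g x - x i * pd j g x) = 0 := by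
    intro k
    have hg : IsTest 1 O (fun x => χ k x * g x) := by
      have := h.mono le_rfl (subset_univ O)
      have := this.mul_left isOpen_univ (hχ k).contDiffOn
      exact ⟨this.1, this.2, tsupport_mul_subset_right.trans h.subset⟩
    have hx : ∀ l, IsTest 1 univ (fun x : E n => x l * (χ k x * g x)) := fun l =>
      (hg.mono le_rfl (subset_univ O)).mul_left isOpen_univ (contDiff_coord l).contDiffOn
    have e := (hx j).integral_pd_eq_zero le_rfl i
    have e' := (hx i).integral_pd_eq_zero le_rfl j
    rw [← sub_eq_zero_of_eq (e.trans e'.symm), ← integral_sub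
      ((hx j).pderiv (m := 0) (by simp) i).integrable ((hx i).pderiv (m := 0) (by simp) j).integrable]
    refine integral_congr_ae (ae_of_all _ fun x => ?_)
    have dχ := ((hχ k).contDiffAt (x := x)).differentiableAt one_ne_zero
    have dg := h.differentiableAt le_rfl x
    have dm : DifferentiableAt ℝ (fun y => χ k y * g y) x := dχ.mul dg
    simp only
    rw [pd_mul (differentiableAt_coord j x) dm, pd_mul (differentiableAt_coord i x) dm,
      pd_mul dχ dg, pd_mul dχ dg, hpχ, hpχ, pd_coord, pd_coord]
    simp only [eq_comm (a := i) (b := j)]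
    ring
  have hint : Integrable (fun x : E n => x j * pd i g x - x i * pd j g x) := by
    have h0 : ∀ l m, IsTest 0 univ (fun x : E n => x l * pd m g x) := fun l m =>
      ((h.pderiv (m := 0) (by simp) m).mono le_rfl (subset_univ O)).mul_left isOpen_univ
        (contDiff_coord l).contDiffOn
    exact (h0 j i).integrable.sub (h0 i j).integrable
  have hlim := tendsto_integral_of_dominated_convergence
    (F := fun (k : ℕ) x => χ k x * (x j * pd i g x - x i * pd j g x))
    (f := indicator {x : E n | R < ‖x‖} fun x => x j * pd i g x - x i * pd j g x)
    (μ := volume) (fun x => ‖x j * pd i g x - x i * pd j g x‖)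
    (fun k => (hχ k).continuous.aestronglyMeasurable.mul hint.1) hint.norm
    (fun k => ae_of_all _ fun x => ?_) (ae_of_all _ fun x => ?_)
  · simp only [hzero] at hlim
    rw [← integral_indicator hm]
    exact (tendsto_nhds_unique hlim tendsto_const_nhds)
  · rw [norm_mul]
    refine mul_le_of_le_one_left (norm_nonneg _) ?_
    rw [Real.norm_of_nonneg (Real.smoothTransition.nonneg _)]
    exact Real.smoothTransition.le_one _
  · by_cases hx : R < ‖x‖
    · rw [indicator_of_mem (by exact hx)]
      have hpos : 0 < ‖x‖ ^ 2 - R ^ 2 := by nlinarith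
      refine Filter.Tendsto.congr' ?_ tendsto_const_nhds
      obtain ⟨N, hN⟩ := exists_nat_gt (1 / (‖x‖ ^ 2 - R ^ 2))
      filter_upwards [Filter.eventually_ge_atTop N] with k hk
      have : χ k x = 1 := Real.smoothTransition.one_of_one_le (by
        have : (N : ℝ) ≤ k := by exact_mod_cast hk
        rw [div_lt_iff₀ hpos] at hN
        nlinarith)
      rw [this, one_mul]
    · rw [indicator_of_notMem (by exact hx)]
      refine Filter.Tendsto.congr (fun k => ?_) tendsto_const_nhds
      have : χ k x = 0 := Real.smoothTransition.zero_of_nonpos (by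
        refine mul_nonpos_of_nonneg_of_nonpos (by positivity) ?_
        have : 0 ≤ ‖x‖ := norm_nonneg x
        nlinarith)
      rw [this, zero_mul]

end LocHam

namespace LocHam

open Set
open scoped NNReal

variable {n : ℕ} {k : WithTop ℕ∞} {O : Set (E n)} {f g : E n → ℝ} {R : ℝ}

/-- Integration in polar coordinates. -/
theorem integral_polar (hn : 1 ≤ n) {F : E n → ℝ} (hF : Integrable F) :
    ∫ x, F x = ∫ θ, (∫ r in Ioi (0 : ℝ), r ^ (n - 1) * F (r • (θ : E n)))
      ∂(volume : Measure (E n)).toSphere := by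
  have hd : Module.finrank ℝ (E n) = n := by simp
  have : Nontrivial (E n) := Module.nontrivial_of_finrank_pos (R := ℝ) (by omega)
  have hmp := (volume : Measure (E n)).measurePreserving_homeomorphUnitSphereProd
  rw [hd] at hmp
  have hemb := (homeomorphUnitSphereProd (E n)).measurableEmbedding
  have hcomp : ∀ x : ({0}ᶜ : Set (E n)), F (((homeomorphUnitSphereProd (E n) x).2 : ℝ) •
      ((homeomorphUnitSphereProd (E n) x).1 : E n)) = F x := fun x => by
    have hx : ‖(x : E n)‖ ≠ 0 := norm_ne_zero_iff.2 x.2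
    simp [smul_smul, hx]
  have h1 : ∫ x, F x = ∫ z, F ((z.2 : ℝ) • (z.1 : E n))
      ∂((volume : Measure (E n)).toSphere.prod (Measure.volumeIoiPow (n - 1))) := by
    rw [← hmp.integral_comp hemb]
    simp only [hcomp]
    rw [integral_subtype_comap (measurableSet_singleton _).compl F,
      restrict_compl_singleton]
  have h2 : Integrable (fun z : Metric.sphere (0 : E n) 1 × Ioi (0 : ℝ) =>
      F ((z.2 : ℝ) • (z.1 : E n)))
      ((volume : Measure (E n)).toSphere.prod (Measure.volumeIoiPow (n - 1))) := by
    rw [← hmp.integrable_comp_emb hemb]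
    have : ((fun z : Metric.sphere (0 : E n) 1 × Ioi (0 : ℝ) => F ((z.2 : ℝ) • (z.1 : E n))) ∘
      homeomorphUnitSphereProd (E n)) = F ∘ Subtype.val := funext hcomp
    rw [this, ← integrableOn_iff_comap_subtypeVal (measurableSet_singleton _).compl]
    exact hF.integrableOn
  rw [h1, integral_prod _ h2]
  refine integral_congr_ae (ae_of_all _ fun θ => ?_)
  simp only [Measure.volumeIoiPow, ENNReal.ofReal]
  rw [integral_withDensity_eq_integral_smul ((measurable_subtype_coe.pow_const _).real_toNNReal),
    integral_subtype_comap measurableSet_Ioi fun a : ℝ => Real.toNNReal (a ^ (n - 1)) • F (a • (θ : E n)),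
    setIntegral_congr_fun measurableSet_Ioi fun x hx => ?_]
  rw [NNReal.smul_def, Real.coe_toNNReal _ (pow_nonneg (le_of_lt hx) _), smul_eq_mul]

theorem IsTest.setIntegral_theta_add (hn : 1 ≤ n) (h : IsTest 1 O g) (hR : 0 < R) :
    ∫ x in {x : E n | R < ‖x‖}, (theta g x + n * g x) =
      -(R ^ n * ∫ θ, g (R • (θ : E n)) ∂(volume : Measure (E n)).toSphere) := by
  have hm : MeasurableSet {x : E n | R < ‖x‖} :=
    (isOpen_lt continuous_const continuous_norm).measurableSet
  have hc : Continuous (theta g) :=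
    (h.contDiff.continuous_fderiv one_ne_zero).clm_apply continuous_id
  have hs : HasCompactSupport (theta g) := by
    refine h.compact.mono' ?_
    intro x hx
    exact (tsupport_fderiv_subset ℝ) (subset_closure fun h0 => hx (by simp [theta, h0]))
  have hint : Integrable (fun x : E n => theta g x + n * g x) :=
    (hc.integrable_of_hasCompactSupport hs).add (h.integrable.const_mul _)
  rw [← integral_indicator hm, integral_polar hn (hint.indicator hm), ← integral_const_mul,
    ← integral_neg]
  refine integral_congr_ae (ae_of_all _ fun θ => ?_)
  have hθ : ‖(θ : E n)‖ = 1 := by simp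
  have hθ0 : (θ : E n) ≠ 0 := fun h0 => by simp [h0] at hθ
  have hd : ∀ r : ℝ, HasDerivAt (fun r : ℝ => r ^ n * g (r • (θ : E n)))
      (r ^ (n - 1) * (theta g (r • (θ : E n)) + n * g (r • (θ : E n)))) r := by
    intro r
    have h1 : HasDerivAt (fun r : ℝ => r • (θ : E n)) (θ : E n) r := by
      simpa using (hasDerivAt_id r).smul_const (θ : E n)
    have h2 := (h.differentiableAt le_rfl (r • (θ : E n))).hasFDerivAt.comp_hasDerivAt r h1
    refine ((hasDerivAt_pow n r).mul h2).congr_deriv ?_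
    simp only [Function.comp_apply]
    have h3 : theta g (r • (θ : E n)) = r * fderiv ℝ g (r • (θ : E n)) θ := by
      simp [theta]
    rw [h3]
    obtain ⟨m, rfl⟩ : ∃ m, n = m + 1 := ⟨n - 1, by omega⟩
    simp only [Nat.add_sub_cancel]
    push_cast
    ring
  have hcd : ContDiff ℝ 1 (fun r : ℝ => r ^ n * g (r • (θ : E n))) :=
    (contDiff_id.pow n).mul (h.contDiff.comp (contDiff_id.smul contDiff_const))
  have hcs : HasCompactSupport (fun r : ℝ => r ^ n * g (r • (θ : E n))) := by
    refine HasCompactSupport.mul_left (f := fun r : ℝ => r ^ n) ?_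
    exact h.compact.comp_isClosedEmbedding (isClosedEmbedding_smul_left hθ0)
  have hfin := hcs.integral_Ioi_deriv_eq hcd R
  simp only [(hd _).deriv] at hfin
  refine Eq.trans ?_ hfin
  simp only
  rw [← integral_indicator measurableSet_Ioi, ← integral_indicator measurableSet_Ioi]
  congr 1
  ext r
  by_cases hr : R < r
  · have hr0 : 0 < r := hR.trans hr
    have hmem : r • (θ : E n) ∈ {x : E n | R < ‖x‖} := by
      simpa [norm_smul, hθ, abs_of_pos hr0] using hr
    rw [indicator_of_mem (mem_Ioi.2 hr0), indicator_of_mem (mem_Ioi.2 hr), indicator_of_mem hmem]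
  · rw [indicator_of_notMem (s := Ioi R) hr]
    by_cases hr0 : 0 < r
    · have hmem : r • (θ : E n) ∉ {x : E n | R < ‖x‖} := by
        simpa [norm_smul, hθ, abs_of_pos hr0] using hr
      rw [indicator_of_mem (mem_Ioi.2 hr0), indicator_of_notMem hmem, mul_zero]
    · rw [indicator_of_notMem (s := Ioi (0 : ℝ)) hr0]

/-- The divergence theorem outside of a ball, for the field `|x|² Z`. -/
theorem setIntegral_div_eq (hn : 1 ≤ n) {Z : Fin n → E n → ℝ} (hZ : ∀ i, IsTest 1 O (Z i))
    (hR : 0 < R) :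
    ∫ x in {x : E n | R < ‖x‖}, ∑ i, pd i (fun y => ‖y‖ ^ 2 * Z i y) x =
      -(R ^ n * ∫ θ, ∑ i, (R • (θ : E n)) i * Z i (R • (θ : E n))
        ∂(volume : Measure (E n)).toSphere) := by
  have hxZ : ∀ i j, IsTest 1 univ (fun y => y j * Z i y) := fun i j =>
    ((hZ i).mono le_rfl (subset_univ O)).mul_left isOpen_univ (contDiff_coord j).contDiffOn
  have hh : IsTest 1 univ (fun y => ∑ i, y i * Z i y) := IsTest.sum _ fun i _ => hxZ i i
  rw [← hh.setIntegral_theta_add hn hR]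
  have hrot : ∑ i, ∑ j, ∫ x in {x : E n | R < ‖x‖}, (x j * pd i (fun y => y j * Z i y) x -
      x i * pd j (fun y => y j * Z i y) x) = 0 :=
    Finset.sum_eq_zero fun i _ => Finset.sum_eq_zero fun j _ =>
      (hxZ i j).setIntegral_rot_eq_zero R hR i j
  have hirot : ∀ i j, Integrable (fun x : E n => x j * pd i (fun y => y j * Z i y) x -
      x i * pd j (fun y => y j * Z i y) x) := fun i j => by
    have h0 : ∀ l m, IsTest 0 univ (fun x : E n => x l * pd m (fun y => y j * Z i y) x) :=
      fun l m => ((hxZ i j).pderiv (m := 0) (by simp) m).mul_left isOpen_univ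
        (contDiff_coord l).contDiffOn
    exact (h0 j i).integrable.sub (h0 i j).integrable
  have hith : Integrable (fun x : E n => theta (fun y => ∑ i, y i * Z i y) x +
      n * ∑ i, x i * Z i x) := by
    refine Integrable.add ?_ (hh.integrable.const_mul _)
    have : theta (fun y => ∑ i, y i * Z i y) = fun x => ∑ l, x l * pd l (fun y => ∑ i, y i * Z i y) x := by
      ext x
      exact theta_eq_sum _ _
    rw [this]
    exact (IsTest.sum _ fun l _ => (hh.pderiv (m := 0) (by simp) l).mul_left isOpen_univ
        (contDiff_coord l).contDiffOn).integrable
  simp only [← integral_finsetSum _ fun j _ => (hirot _ j).integrableOn] at hrot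
  rw [← integral_finsetSum _ fun i _ => integrable_finsetSum _ fun j _ => (hirot i j).integrableOn] at hrot
  rw [← sub_eq_zero, ← integral_sub _ hith.integrableOn, ← hrot]
  · refine integral_congr_ae (ae_of_all _ fun x => ?_)
    have dZ : ∀ i, DifferentiableAt ℝ (Z i) x := fun i => (hZ i).differentiableAt le_rfl x
    have dn : DifferentiableAt ℝ (fun y : E n => ‖y‖ ^ 2) x :=
      (contDiff_norm_sq ℝ (n := 1)).contDiffAt.differentiableAt one_ne_zero
    have dxZ : ∀ i, DifferentiableAt ℝ (fun y => y i * Z i y) x := fun i =>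
      (differentiableAt_coord i x).mul (dZ i)
    have e1 : ∀ i j l, pd l (fun y => y j * Z i y) x =
        x j * pd l (Z i) x + Z i x * if l = j then 1 else 0 := fun i j l => by
      rw [pd_mul (differentiableAt_coord j x) (dZ i), pd_coord]
    have e2 : ∀ i, pd i (fun y => ‖y‖ ^ 2 * Z i y) x = ‖x‖ ^ 2 * pd i (Z i) x + 2 * (x i * Z i x) :=
      fun i => by
      rw [pd_mul dn (dZ i), pd_norm_sq]
      ring
    have e3 : theta (fun y => ∑ i, y i * Z i y) x =
        ∑ l, ∑ i, x l * (x i * pd l (Z i) x) + ∑ i, x i * Z i x := by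
      rw [theta_eq_sum, ← Finset.sum_add_distrib]
      refine Finset.sum_congr rfl fun l _ => ?_
      rw [pd_sum fun i _ => dxZ i, ← Finset.mul_sum, ← mul_add]
      simp only [e1, Finset.sum_add_distrib]
      simp
    have e4 : ∑ i, ∑ j, (x j * pd i (fun y => y j * Z i y) x -
        x i * pd j (fun y => y j * Z i y) x) = ‖x‖ ^ 2 * ∑ i, pd i (Z i) x + ∑ i, x i * Z i x -
          ∑ l, ∑ i, x l * (x i * pd l (Z i) x) - n * ∑ i, x i * Z i x := by
      rw [Finset.sum_comm (f := fun l i => x l * (x i * pd l (Z i) x))]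
      simp only [e1, if_true, EuclideanSpace.real_norm_sq_eq, Finset.mul_sum, Finset.sum_mul,
        ← Finset.sum_add_distrib, ← Finset.sum_sub_distrib]
      refine Finset.sum_congr rfl fun i _ => ?_
      simp only [mul_add, Finset.sum_add_distrib, Finset.sum_sub_distrib]
      simp only [mul_ite, mul_one, mul_zero, Finset.sum_ite_eq, Finset.mem_univ, if_true,
        Finset.sum_const, Finset.card_univ, Fintype.card_fin, nsmul_eq_mul]
      have h1 : ∑ j, x j * (x j * pd i (Z i) x) = ∑ j, x j ^ 2 * pd i (Z i) x :=
        Finset.sum_congr rfl fun j _ => by ring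
      have h2 : ∑ j, x i * (x j * pd j (Z i) x) = ∑ j, x j * (x i * pd j (Z i) x) :=
        Finset.sum_congr rfl fun j _ => by ring
      rw [h1, h2]
      ring
    simp only
    rw [e3, e4]
    simp only [e2, Finset.sum_add_distrib, ← Finset.mul_sum]
    ring
  · refine (integrable_finsetSum _ fun i _ => ?_).integrableOn
    exact ((((hZ i).mono le_rfl (subset_univ O)).mul_left isOpen_univ
      (contDiff_norm_sq ℝ).contDiffOn).pderiv (m := 0) (by simp) i).integrable

end LocHam

namespace LocHam

open Set
open scoped NNReal

variable {n : ℕ} {K : Set (E n)} {lam : E n → ℝ} {P R q : ℝ} {k : WithTop ℕ∞} {O : Set (E n)}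
  {f g ψ : E n → ℝ}

theorem IsTest.memWL2 (hK : IsConicalLocalization K lam) (h : IsTest 0 K g) :
    MemWL2 K lam P R q g := by
  refine ⟨h.contDiff.continuous.aestronglyMeasurable, ?_⟩
  refine (ENNReal.pow_lt_top_iff (n := 2).1 ?_).resolve_right two_ne_zero
  rw [sq_eLpNorm_two, lintegral_wMeasure hK]
  have hi : IsTest 0 K (fun x => wt lam P q x * (g x * g x)) :=
    (h.mul_left hK.isOpen h.contDiff.contDiffOn).mul_left hK.isOpen ((contDiffOn_wt hK).of_le (by simp))
  refine lt_of_le_of_lt ?_ hi.integrable.2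
  refine (setLIntegral_mono_ae' hK.isOpen_Om.measurableSet (ae_of_all _ fun x hx => ?_)).trans
    (setLIntegral_le_lintegral (Om K R) _)
  rw [enorm_mul, Real.enorm_eq_ofReal (wt_pos hK hx.1).le, enorm_mul, sq]

theorem IsTest.isH2With (hK : IsConicalLocalization K lam) (h : IsTest ∞ K g) :
    IsH2With K lam P R q g (fun i => pd i g) (fun i j => pd i (pd j g)) := by
  refine ⟨(h.mono (by simp) le_rfl).memWL2 hK, fun i => (h.pderiv (by simp) i).memWL2 hK,
    fun i j => ((h.pderiv (m := 1) (by norm_cast) j).pderiv (by simp) i).memWL2 hK,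
    fun ε hε => ⟨g, h.contDiff.contDiffOn, ?_⟩⟩
  simpa [wNorm] using ⟨hε, fun _ => hε, fun _ _ => hε⟩

theorem pd_eq_zero_of_notMem {x : E n} (hx : x ∉ tsupport g) (i : Fin n) : pd i g x = 0 :=
  image_eq_zero_of_notMem_tsupport fun h => hx (tsupport_fderiv_apply_subset ℝ _ h)

theorem IsTest.integral_mul_pd (hO : IsOpen O) (h : IsTest 1 O ψ) (hf : ContDiffOn ℝ 1 f O)
    (i : Fin n) : ∫ x, pd i f x * ψ x = -∫ x, f x * pd i ψ x := by
  have h1 := (h.mul_left hO hf).integral_pd_eq_zero le_rfl i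
  have h2 : ∀ x, pd i (fun y => f y * ψ y) x = f x * pd i ψ x + pd i f x * ψ x := by
    intro x
    by_cases hx : x ∈ tsupport ψ
    · rw [pd_mul (differentiableAt_of_contDiffOn hO hf le_rfl (h.subset hx))
        (h.differentiableAt le_rfl x)]
      ring
    · have hx' : x ∉ tsupport fun y => f y * ψ y := fun h' => hx (tsupport_mul_subset_right h')
      rw [pd_eq_zero_of_notMem hx, pd_eq_zero_of_notMem hx', image_eq_zero_of_notMem_tsupport hx]
      ring
  simp only [h2] at h1
  rw [integral_add] at h1
  · linarith
  · exact ((h.pderiv (m := 0) (by simp) i).mul_left hO (hf.of_le (by simp))).integrable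
  · exact ((h.mono (m := 0) (by simp) le_rfl).mul_left hO
      (contDiffOn_pd hO hf (by simp) i)).integrable

theorem IsTest.integral_mul_pd_pd (hO : IsOpen O) (h : IsTest 2 O ψ) (hf : ContDiffOn ℝ 2 f O)
    (i j : Fin n) : ∫ x, pd i (pd j f) x * ψ x = ∫ x, f x * pd j (pd i ψ) x := by
  have h2 : (1 : WithTop ℕ∞) + 1 ≤ 2 := by norm_num
  rw [(h.mono (m := 1) (by norm_num) le_rfl).integral_mul_pd hO (contDiffOn_pd hO hf h2 j),
    (h.pderiv h2 i).integral_mul_pd hO (hf.of_le (by norm_num)), neg_neg]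

theorem exists_lintegral_le_wNorm (hK : IsConicalLocalization K lam) {s : Set (E n)}
    (hs : IsCompact s) (hsO : s ⊆ Om K R) (P q : ℝ) : ∃ C : ℝ≥0∞, C ≠ ⊤ ∧ ∀ h : E n → ℝ,
      AEStronglyMeasurable h (wMeasure K lam P R q) →
        ∫⁻ x in s, ‖h x‖ₑ ≤ C * wNorm K lam P R q h := by
  have hm := hs.measurableSet
  obtain ⟨c, hc, hcs⟩ : ∃ c : ℝ, 0 < c ∧ ∀ x ∈ s, c ≤ wt lam P q x := by
    rcases s.eq_empty_or_nonempty with rfl | hne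
    · exact ⟨1, one_pos, by simp⟩
    · obtain ⟨x, hx, hmin⟩ := hs.exists_isMinOn hne
        ((contDiffOn_wt (P := P) (q := q) hK).continuousOn.mono (hsO.trans inter_subset_left))
      exact ⟨_, wt_pos hK (hsO hx).1, fun y hy => hmin hy⟩
  have hle : volume.restrict s ≤ (ENNReal.ofReal c)⁻¹ • wMeasure K lam P R q := by
    refine Measure.le_iff.2 fun t ht => ?_
    have hc0 : ENNReal.ofReal c ≠ 0 := by simpa using hc
    rw [Measure.smul_apply, smul_eq_mul, mul_comm, ← div_eq_mul_inv, ENNReal.le_div_iff_mul_le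
      (Or.inl hc0) (Or.inl ENNReal.ofReal_ne_top), wMeasure_eq, withDensity_apply _ ht,
      Measure.restrict_restrict ht, Measure.restrict_apply ht, mul_comm, ← setLIntegral_const]
    refine le_trans (setLIntegral_mono_ae' (ht.inter hm) (ae_of_all _ fun x hx =>
      ENNReal.ofReal_le_ofReal (hcs x hx.2))) (lintegral_mono_set (inter_subset_inter_right t hsO))
  have hac : volume.restrict s ≪ wMeasure K lam P R q :=
    (Measure.absolutelyContinuous_of_le hle).trans (Measure.smul_absolutelyContinuous)
  refine ⟨(ENNReal.ofReal c)⁻¹ ^ (1 / (2 : ℝ)) * volume s ^ (1 / (2 : ℝ)), ?_, fun h hh => ?_⟩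
  · refine ENNReal.mul_ne_top (ENNReal.rpow_ne_top_of_nonneg (by norm_num) ?_)
      (ENNReal.rpow_ne_top_of_nonneg (by norm_num) hs.measure_ne_top)
    simpa using hc
  · rw [← eLpNorm_one_eq_lintegral_enorm]
    refine (eLpNorm_le_eLpNorm_mul_rpow_measure_univ (p := 1) (q := 2) (by norm_num)
      (hh.mono_ac hac)).trans ?_
    have h1 := eLpNorm_mono_measure h (p := 2) hle
    rw [eLpNorm_smul_measure_of_ne_top (by norm_num)] at h1
    rw [Measure.restrict_apply_univ]
    refine (mul_le_mul_left h1 _).trans (le_of_eq ?_)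
    rw [wNorm, smul_eq_mul]
    norm_num
    ring

theorem MemWL2.locallyIntegrableOn (hK : IsConicalLocalization K lam)
    (hf : MemWL2 K lam P R q f) : LocallyIntegrableOn f (Om K R) := by
  rw [locallyIntegrableOn_iff hK.isOpen_Om.isLocallyClosed]
  intro s hsO hs
  obtain ⟨C, hC, h⟩ := exists_lintegral_le_wNorm hK hs hsO P q
  refine ⟨(hf.1.mono_ac (restrict_absolutelyContinuous_wMeasure hK)).mono_measure
    (Measure.restrict_mono hsO le_rfl), ?_⟩
  exact (h f hf.1).trans_lt (ENNReal.mul_lt_top hC.lt_top hf.2)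

theorem exists_enorm_integral_mul_le (hK : IsConicalLocalization K lam) (h : IsTest 0 (Om K R) ψ)
    (P q : ℝ) : ∃ C : ℝ≥0∞, C ≠ ⊤ ∧ ∀ h : E n → ℝ,
      AEStronglyMeasurable h (wMeasure K lam P R q) →
        ‖∫ x, h x * ψ x‖ₑ ≤ C * wNorm K lam P R q h := by
  obtain ⟨C, hC, hC'⟩ := exists_lintegral_le_wNorm hK h.compact h.subset P q
  obtain ⟨M, hM⟩ := h.contDiff.continuous.bounded_above_of_compact_support h.compact
  refine ⟨ENNReal.ofReal M * C, ENNReal.mul_ne_top ENNReal.ofReal_ne_top hC, fun a ha => ?_⟩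
  calc
    _ ≤ ∫⁻ x, ‖a x * ψ x‖ₑ := enorm_integral_le_lintegral_enorm _
    _ ≤ ∫⁻ x in tsupport ψ, ENNReal.ofReal M * ‖a x‖ₑ := by
      rw [← lintegral_indicator h.compact.measurableSet]
      refine lintegral_mono fun x => ?_
      by_cases hx : x ∈ tsupport ψ
      · rw [indicator_of_mem hx, enorm_mul, mul_comm]
        gcongr
        rw [← ofReal_norm]
        exact ENNReal.ofReal_le_ofReal (hM x)
      · simp [indicator_of_notMem hx, image_eq_zero_of_notMem_tsupport hx]
    _ ≤ _ := by
      rw [lintegral_const_mul' _ _ ENNReal.ofReal_ne_top, mul_assoc]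
      gcongr
      exact hC' a ha

/-- The Hessian of a classically differentiable element of `H²` is its classical Hessian. -/
theorem IsH2With.hess_ae_eq (hK : IsConicalLocalization K lam) {u : E n → ℝ}
    {G : Fin n → E n → ℝ} {D : Fin n → Fin n → E n → ℝ} (h : IsH2With K lam P R q u G D)
    (hu : ContDiffOn ℝ 2 u (Om K R)) (i j : Fin n) :
    ∀ᵐ x, x ∈ Om K R → D i j x = pd i (pd j u) x := by
  have hO := hK.isOpen_Om (R := R)
  have h2 : (1 : WithTop ℕ∞) + 1 ≤ 2 := by norm_num
  have hcu : ContinuousOn (pd i (pd j u)) (Om K R) := continuousOn_pd hO (contDiffOn_pd hO hu h2 j) i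
  have hloc : LocallyIntegrableOn (fun x => D i j x - pd i (pd j u) x) (Om K R) :=
    ((h.mem_hess i j).locallyIntegrableOn hK).sub (hcu.locallyIntegrableOn hO.measurableSet)
  have main := hO.ae_eq_zero_of_integral_contDiff_smul_eq_zero hloc fun ψ h1 h3 h4 => ?_
  · filter_upwards [main] with x hx hxO
    exact sub_eq_zero.1 (hx hxO)
  have hψ : IsTest ∞ (Om K R) ψ := ⟨h1, h3, h4⟩
  have hψ2 : IsTest 2 (Om K R) ψ := hψ.mono (by norm_cast) le_rfl
  obtain ⟨C, hC, hC'⟩ := exists_enorm_integral_mul_le hK (hψ.mono (m := 0) (by simp) le_rfl) P (q + 2)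
  obtain ⟨C1, hC1, hC1'⟩ := exists_enorm_integral_mul_le hK
    ((hψ2.pderiv h2 i).pderiv (m := 0) (by simp) j) P q
  have hcs : IsCompact (tsupport ψ) := hψ.compact
  have int_mul : ∀ {a : E n → ℝ}, LocallyIntegrableOn a (Om K R) → Integrable fun x => a x * ψ x := by
    intro a ha
    have hs : IntegrableOn (fun x => a x * ψ x) (tsupport ψ) :=
      (ha.integrableOn_compact_subset hψ.subset hcs).mul_continuousOn
        hψ.contDiff.continuous.continuousOn hcs
    rwa [integrableOn_iff_integrable_of_support_subset] at hs
    intro x hx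
    by_contra hx'
    exact hx (by simp [image_eq_zero_of_notMem_tsupport hx'])
  have bound : ∀ ε : ℝ≥0∞, 0 < ε →
      ‖∫ x, (D i j x - pd i (pd j u) x) * ψ x‖ₑ ≤ C * ε + C1 * ε := by
    intro ε hε
    obtain ⟨φ, hφ, k0, -, k2⟩ := h.approx ε hε
    have hφ2 : ContDiffOn ℝ 2 φ (Om K R) := hφ.of_le (by norm_cast)
    have hcφ : ContinuousOn (pd i (pd j φ)) (Om K R) :=
      continuousOn_pd hO (contDiffOn_pd hO hφ2 h2 j) i
    have e1 : ∫ x, (D i j x - pd i (pd j u) x) * ψ x =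
        (∫ x, (D i j x - pd i (pd j φ) x) * ψ x) -
          ∫ x, (u x - φ x) * pd j (pd i ψ) x := by
      rw [← hψ2.integral_mul_pd_pd hO (hu.sub hφ2), ← integral_sub]
      · refine integral_congr_ae (ae_of_all _ fun x => ?_)
        by_cases hx : x ∈ Om K R
        · have e2 : ∀ y ∈ Om K R, pd j (fun x => u x - φ x) y = pd j u y - pd j φ y := fun y hy =>
            pd_sub (differentiableAt_of_contDiffOn hO hu (by norm_num) hy)
              (differentiableAt_of_contDiffOn hO hφ2 (by norm_num) hy) j
          have e3 : pd i (pd j (fun x => u x - φ x)) x = pd i (pd j u) x - pd i (pd j φ) x := by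
            rw [pd_congr_of_eqOn hO hx e2, pd_sub
              (differentiableAt_of_contDiffOn hO (contDiffOn_pd hO hu h2 j) le_rfl hx)
              (differentiableAt_of_contDiffOn hO (contDiffOn_pd hO hφ2 h2 j) le_rfl hx)]
          change _ = _ - pd i (pd j (fun x => u x - φ x)) x * ψ x
          rw [e3]
          ring
        · simp [hψ.eq_zero hx]
      · exact int_mul (((h.mem_hess i j).locallyIntegrableOn hK).sub
          (hcφ.locallyIntegrableOn hO.measurableSet))
      · exact int_mul ((continuousOn_pd hO (contDiffOn_pd hO (hu.sub hφ2) h2 j) i).locallyIntegrableOn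
          hO.measurableSet)
    rw [e1]
    refine (enorm_sub_le).trans (add_le_add ?_ ?_)
    · refine (hC' _ ((h.mem_hess i j).1.sub (aestronglyMeasurable_of_continuousOn hK hcφ))).trans ?_
      gcongr
      exact (k2 i j).le
    · refine (hC1' _ (h.mem.1.sub (aestronglyMeasurable_of_continuousOn hK hφ.continuousOn))).trans ?_
      gcongr
      exact k0.le
  have hz : ‖∫ x, (D i j x - pd i (pd j u) x) * ψ x‖ₑ = 0 := by
    refine le_antisymm (ENNReal.le_of_forall_pos_le_add fun δ hδ _ => ?_) (by simp)
    have hCC : C + C1 + 1 ≠ ⊤ := by finiteness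
    refine (bound (δ / (C + C1 + 1)) (ENNReal.div_pos (by simpa using hδ.ne') hCC)).trans ?_
    rw [zero_add, ← add_mul]
    refine le_trans (mul_le_mul_left (le_self_add (b := 1)) _) (ENNReal.mul_div_le)
  simpa [mul_comm] using hz

end LocHam

namespace LocHam

open Set
open scoped NNReal

variable {n : ℕ} {O : Set (E n)} {R : ℝ} {M : Fin n → Fin n → E n → ℝ} {w : E n → ℝ}

theorem pd_comm {f : E n → ℝ} {x : E n} (hf : ContDiffAt ℝ 2 f x) (i j : Fin n) :
    pd i (pd j f) x = pd j (pd i f) x := by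
  have hd : DifferentiableAt ℝ (fderiv ℝ f) x :=
    (hf.fderiv_right (m := 1) (by norm_num)).differentiableAt one_ne_zero
  have key : ∀ a b : Fin n, pd a (pd b f) x =
      fderiv ℝ (fderiv ℝ f) x (EuclideanSpace.single a 1) (EuclideanSpace.single b 1) := by
    intro a b
    change fderiv ℝ (fun y => fderiv ℝ f y (EuclideanSpace.single b 1)) x _ = _
    rw [fderiv_clm_apply hd (differentiableAt_const _)]
    simp
  rw [key, key]
  exact (hf.isSymmSndFDerivAt (by simp)).eq _ _

/-- The vector field whose divergence is `M : ∂²w - w ∂²M`. -/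
noncomputable def greenField (M : Fin n → Fin n → E n → ℝ) (w : E n → ℝ) (i : Fin n) (x : E n) : ℝ :=
  ∑ j, (M i j x * pd j w x - pd j (M i j) x * w x)

theorem one_add_one_le_two : (1 : WithTop ℕ∞) + 1 ≤ 2 := by norm_num

theorem isTest_greenField (hO : IsOpen O) (hM : ∀ i j, ContDiffOn ℝ 2 (M i j) O)
    (hw : IsTest ∞ O w) (i : Fin n) : IsTest 1 O (greenField M w i) := by
  refine IsTest.sum _ fun j _ => IsTest.sub ?_ ?_
  · exact (hw.pderiv (by norm_cast) j).mul_left hO ((hM i j).of_le (by norm_num))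
  · exact (hw.mono (by norm_cast) le_rfl).mul_left hO (contDiffOn_pd hO (hM i j) one_add_one_le_two j)

theorem div_greenField (hO : IsOpen O) (hM : ∀ i j, ContDiffOn ℝ 2 (M i j) O)
    (hsymm : ∀ i j, EqOn (M i j) (M j i) O) (hw : IsTest ∞ O w) {x : E n} (hx : x ∈ O) :
    ∑ i, pd i (greenField M w i) x = ∑ i, ∑ j, M i j x * pd i (pd j w) x -
      (∑ i, ∑ j, pd i (pd j (M i j)) x) * w x := by
  have dM : ∀ i j, DifferentiableAt ℝ (M i j) x := fun i j =>
    differentiableAt_of_contDiffOn hO (hM i j) (by norm_num) hx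
  have dM' : ∀ i j, DifferentiableAt ℝ (pd j (M i j)) x := fun i j =>
    differentiableAt_of_contDiffOn hO (contDiffOn_pd hO (hM i j) one_add_one_le_two j) le_rfl hx
  have dw : DifferentiableAt ℝ w x := hw.differentiableAt (by simp) x
  have dw' : ∀ j, DifferentiableAt ℝ (pd j w) x := fun j =>
    (hw.pderiv (m := 1) (by norm_cast) j).differentiableAt le_rfl x
  have e1 : ∀ i, pd i (greenField M w i) x = ∑ j, (M i j x * pd i (pd j w) x +
      pd j w x * pd i (M i j) x - (pd j (M i j) x * pd i w x + w x * pd i (pd j (M i j)) x)) := by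
    intro i
    have d1 : ∀ j, DifferentiableAt ℝ (fun x => M i j x * pd j w x) x := fun j =>
      (dM i j).mul (dw' j)
    have d2 : ∀ j, DifferentiableAt ℝ (fun x => pd j (M i j) x * w x) x := fun j =>
      (dM' i j).mul dw
    have d3 : ∀ j, DifferentiableAt ℝ (fun x => M i j x * pd j w x - pd j (M i j) x * w x) x :=
      fun j => (d1 j).sub (d2 j)
    change pd i (fun x => ∑ j, (M i j x * pd j w x - pd j (M i j) x * w x)) x = _
    rw [pd_sum fun j _ => d3 j]
    refine Finset.sum_congr rfl fun j _ => ?_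
    rw [pd_sub (d1 j) (d2 j), pd_mul (dM i j) (dw' j), pd_mul (dM' i j) dw]
  have e2 : ∑ i, ∑ j, pd j w x * pd i (M i j) x = ∑ i, ∑ j, pd j (M i j) x * pd i w x := by
    rw [Finset.sum_comm]
    refine Finset.sum_congr rfl fun i _ => Finset.sum_congr rfl fun j _ => ?_
    rw [pd_congr_of_eqOn hO hx (hsymm j i), mul_comm]
  have e3 : (∑ i, ∑ j, pd i (pd j (M i j)) x) * w x = ∑ i, ∑ j, w x * pd i (pd j (M i j)) x := by
    rw [mul_comm]
    simp only [Finset.mul_sum]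
  simp only [e1, Finset.sum_sub_distrib, Finset.sum_add_distrib]
  rw [e2, e3]
  ring

/-- The contraction `V_j = M_{ij} x_i`. -/
noncomputable def radialRow (M : Fin n → Fin n → E n → ℝ) (j : Fin n) (x : E n) : ℝ :=
  ∑ i, M i j x * x i

/-- The coefficient of `ϑ w` in the boundary form. -/
noncomputable def bdryV (M : Fin n → Fin n → E n → ℝ) (x : E n) : ℝ := ∑ j, x j * radialRow M j x

/-- The coefficient of `-w` in the boundary form. -/
noncomputable def bdryQ (M : Fin n → Fin n → E n → ℝ) (x : E n) : ℝ :=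
  ‖x‖ ^ 2 * ∑ i, ∑ j, x i * pd j (M i j) x +
    ∑ i, ∑ j, x i * pd j (fun y => y i * radialRow M j y - y j * radialRow M i y) x

theorem contDiffOn_radialRow (hM : ∀ i j, ContDiffOn ℝ 2 (M i j) O) (j : Fin n) :
    ContDiffOn ℝ 2 (radialRow M j) O :=
  ContDiffOn.sum fun i _ => (hM i j).mul (contDiff_coord i).contDiffOn

theorem contDiffOn_moment (hM : ∀ i j, ContDiffOn ℝ 2 (M i j) O) (i j : Fin n) :
    ContDiffOn ℝ 2 (fun y => y i * radialRow M j y - y j * radialRow M i y) O :=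
  ((contDiff_coord i).contDiffOn.mul (contDiffOn_radialRow hM j)).sub
    ((contDiff_coord j).contDiffOn.mul (contDiffOn_radialRow hM i))

theorem continuousOn_bdryV (hM : ∀ i j, ContDiffOn ℝ 2 (M i j) O) : ContinuousOn (bdryV M) O :=
  continuousOn_finsetSum _ fun j _ => (contDiff_coord (k := 0) j).continuous.continuousOn.mul
    (contDiffOn_radialRow hM j).continuousOn

theorem continuousOn_bdryQ (hO : IsOpen O) (hM : ∀ i j, ContDiffOn ℝ 2 (M i j) O) :
    ContinuousOn (bdryQ M) O := by
  have hc : ∀ i : Fin n, ContinuousOn (fun x : E n => x i) O := fun i =>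
    (contDiff_coord (k := 0) i).continuous.continuousOn
  refine ContinuousOn.add (ContinuousOn.mul (by fun_prop) ?_) ?_
  · exact continuousOn_finsetSum _ fun i _ => continuousOn_finsetSum _ fun j _ =>
      (hc i).mul (continuousOn_pd hO ((hM i j).of_le (by norm_num)) j)
  · exact continuousOn_finsetSum _ fun i _ => continuousOn_finsetSum _ fun j _ =>
      (hc i).mul (continuousOn_pd hO ((contDiffOn_moment hM i j).of_le (by norm_num)) j)

theorem sum_pd_pd_antisymm {A : Fin n → Fin n → E n → ℝ} {x : E n}
    (hA : ∀ i j, ContDiffAt ℝ 2 (A i j) x) (hanti : ∀ i j y, A j i y = -A i j y) :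
    ∑ i, ∑ j, pd i (pd j (A i j)) x = 0 := by
  have h : ∑ i, ∑ j, pd i (pd j (A i j)) x = -∑ i, ∑ j, pd i (pd j (A i j)) x := by
    conv_lhs => rw [Finset.sum_comm]
    simp only [← Finset.sum_neg_distrib]
    refine Finset.sum_congr rfl fun i _ => Finset.sum_congr rfl fun j _ => ?_
    have e : A j i = fun y => (-1) * A i j y := by
      ext y
      rw [hanti]
      ring
    have e' : pd i (A j i) = fun y => (-1) * pd i (A i j) y := by
      ext y
      rw [e, pd_const_mul]
    rw [e', pd_const_mul, pd_comm (hA i j)]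
    ring
  linarith

theorem integral_sphere_eq_zero (hn : 1 ≤ n) (hR : 0 < R) (hO : IsOpen O) (h0 : (0 : E n) ∉ O)
    (hM : ∀ i j, ContDiffOn ℝ 2 (M i j) O) (hw : IsTest ∞ O w)
    (hdiv : ∫ x in {x : E n | R < ‖x‖}, ∑ i, pd i (greenField M w i) x = 0) :
    ∫ θ, (bdryV M (R • (θ : E n)) * theta w (R • (θ : E n)) -
      bdryQ M (R • (θ : E n)) * w (R • (θ : E n))) ∂(volume : Measure (E n)).toSphere = 0 := by
  let B : Fin n → Fin n → E n → ℝ := fun i j y => y i * radialRow M j y - y j * radialRow M i y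
  have hB : ∀ i j, ContDiffOn ℝ 2 (B i j) O := contDiffOn_moment hM
  let A : Fin n → Fin n → E n → ℝ := fun i j y => B i j y * w y
  have hA : ∀ i j, IsTest 2 O (A i j) := fun i j =>
    (hw.mono (by norm_cast) le_rfl).mul_left hO (hB i j)
  let X : Fin n → E n → ℝ := fun i x => R ^ 2 * greenField M w i x - ∑ j, pd j (A i j) x
  have hXA : ∀ i, IsTest 1 O (fun x => ∑ j, pd j (A i j) x) := fun i =>
    IsTest.sum _ fun j _ => (hA i j).pderiv one_add_one_le_two j
  have hY := isTest_greenField hO hM hw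
  have hX : ∀ i, IsTest 1 O (X i) := fun i => ((hY i).const_mul _).sub (hXA i)
  have hne : ∀ x ∈ O, ‖x‖ ^ 2 ≠ 0 := fun x hx h => h0 (by
    have : x = 0 := by simpa using h
    rwa [this] at hx)
  have hS : ∀ i, IsTest 1 O (fun x => (‖x‖ ^ 2)⁻¹ * X i x) := fun i =>
    (hX i).mul_left hO ((contDiff_norm_sq ℝ).contDiffOn.inv hne)
  have hXS : ∀ i, (fun y => ‖y‖ ^ 2 * ((‖y‖ ^ 2)⁻¹ * X i y)) = X i := fun i => by
    ext y
    by_cases hy : y ∈ O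
    · rw [mul_inv_cancel_left₀ (hne y hy)]
    · rw [(hX i).eq_zero hy, mul_zero, mul_zero]
  have hdivX : ∀ x, ∑ i, pd i (X i) x = R ^ 2 * ∑ i, pd i (greenField M w i) x := by
    intro x
    have e : ∀ i, pd i (X i) x = R ^ 2 * pd i (greenField M w i) x - ∑ j, pd i (pd j (A i j)) x := by
      intro i
      have d1 : DifferentiableAt ℝ (fun x => R ^ 2 * greenField M w i x) x :=
        ((hY i).const_mul _).differentiableAt le_rfl x
      rw [pd_sub d1 ((hXA i).differentiableAt le_rfl x), pd_const_mul, pd_sum fun j _ =>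
        ((hA i j).pderiv (m := 1) one_add_one_le_two j).differentiableAt le_rfl x]
    simp only [e, Finset.sum_sub_distrib, ← Finset.mul_sum]
    rw [sum_pd_pd_antisymm (fun i j => (hA i j).contDiff.contDiffAt) fun i j y => ?_, sub_zero]
    simp only [A, B]
    ring
  have hflux := setIntegral_div_eq hn hS hR
  simp only [hXS, hdivX] at hflux
  rw [integral_const_mul, hdiv, mul_zero, eq_comm, neg_eq_zero, mul_eq_zero] at hflux
  have hflux' := hflux.resolve_left (pow_pos hR n).ne'
  have hpt : ∀ θ : Metric.sphere (0 : E n) 1, ∑ i, (R • (θ : E n)) i *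
      ((‖R • (θ : E n)‖ ^ 2)⁻¹ * X i (R • (θ : E n))) = (R ^ 2)⁻¹ *
      (bdryV M (R • (θ : E n)) * theta w (R • (θ : E n)) -
      bdryQ M (R • (θ : E n)) * w (R • (θ : E n))) := by
    intro θ
    have hnorm : ‖R • (θ : E n)‖ = R := by simp [norm_smul, abs_of_pos hR]
    generalize R • (θ : E n) = x at hnorm
    rw [hnorm]
    simp only [mul_left_comm _ (R ^ 2)⁻¹, ← Finset.mul_sum]
    congr 1
    by_cases hx : x ∈ O
    · have eA : ∀ i j, pd j (A i j) x = B i j x * pd j w x + w x * pd j (B i j) x := fun i j =>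
        pd_mul (differentiableAt_of_contDiffOn hO (hB i j) (by norm_num) hx)
          (hw.differentiableAt (by simp) x) j
      have hr : R ^ 2 = ∑ i, x i * x i := by
        rw [← hnorm, EuclideanSpace.real_norm_sq_eq]
        simp only [sq]
      have t1 : ∑ i, x i * (R ^ 2 * greenField M w i x) = R ^ 2 * ∑ j, radialRow M j x * pd j w x -
          R ^ 2 * (∑ i, ∑ j, x i * pd j (M i j) x) * w x := by
        have a1 : ∑ j, radialRow M j x * pd j w x = ∑ i, ∑ j, M i j x * x i * pd j w x := by
          simp only [radialRow, Finset.sum_mul]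
          exact Finset.sum_comm
        rw [a1]
        simp only [greenField, Finset.mul_sum, Finset.sum_mul, ← Finset.sum_sub_distrib]
        exact Finset.sum_congr rfl fun i _ => Finset.sum_congr rfl fun j _ => by ring
      have t2 : ∑ i, x i * ∑ j, pd j (A i j) x = R ^ 2 * ∑ j, radialRow M j x * pd j w x -
          bdryV M x * theta w x + (∑ i, ∑ j, x i * pd j (B i j) x) * w x := by
        rw [hr, theta_eq_sum, bdryV, Finset.sum_mul_sum, Finset.sum_mul_sum]
        simp only [eA, Finset.mul_sum, Finset.sum_mul, ← Finset.sum_sub_distrib,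
          ← Finset.sum_add_distrib]
        refine Finset.sum_congr rfl fun i _ => Finset.sum_congr rfl fun j _ => ?_
        simp only [B]
        ring
      simp only [X, mul_sub, Finset.sum_sub_distrib]
      rw [t1, t2, bdryQ, hnorm]
      ring
    · rw [hw.eq_zero hx, theta, image_eq_zero_of_notMem_tsupport (f := fderiv ℝ w)
        fun h => hx (hw.subset (tsupport_fderiv_subset ℝ h))]
      simp [(hX _).eq_zero hx]
  simp only [hpt, integral_const_mul] at hflux'
  exact (mul_eq_zero.1 hflux').resolve_left (inv_pos.2 (pow_pos hR 2)).ne'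

end LocHam

namespace LocHam

open Set
open scoped NNReal

variable {n : ℕ} {K : Set (E n)} {lam : E n → ℝ} {P R p : ℝ} {O : Set (E n)} {f u w : E n → ℝ}

theorem eq_zero_of_integral_sphere (hR : 0 < R) (hO : IsOpen O) {h : E n → ℝ}
    (hc : ContinuousOn h O) (hint : ∀ ψ, IsTest ∞ O ψ →
      ∫ θ, h (R • (θ : E n)) * ψ (R • (θ : E n)) ∂(volume : Measure (E n)).toSphere = 0)
    {x : E n} (hx : x ∈ O) (hxR : ‖x‖ = R) : h x = 0 := by
  by_contra hne
  let O' := O ∩ (fun y => h x * h y) ⁻¹' Ioi 0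
  have hO' : IsOpen O' := (continuousOn_const.mul hc).isOpen_inter_preimage hO isOpen_Ioi
  have hxO' : x ∈ O' := ⟨hx, by simpa using mul_self_pos.2 hne⟩
  obtain ⟨ψ, h1, h2, h3, h4, h5⟩ := exists_contDiff_tsupport_subset (n := ⊤) (hO'.mem_nhds hxO')
  have hψ : IsTest ∞ O' ψ := ⟨h3, h2, h1⟩
  have hF : IsTest 0 O (fun y => h x * (h y * ψ y)) :=
    ((hψ.mono (by simp) inter_subset_left).mul_left hO (contDiffOn_zero.2 hc)).const_mul _
  let θ0 : Metric.sphere (0 : E n) 1 := ⟨R⁻¹ • x, by simp [norm_smul, hxR, abs_of_pos hR, hR.ne']⟩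
  have hθ0 : R • (θ0 : E n) = x := by simp [θ0, smul_smul, hR.ne']
  have hpos : 0 < ∫ θ, (fun θ : Metric.sphere (0 : E n) 1 => h x * (h (R • (θ : E n)) * ψ (R • (θ : E n)))) θ
      ∂(volume : Measure (E n)).toSphere := by
    refine Continuous.integral_pos_of_hasCompactSupport_nonneg_nonzero (x := θ0) ?_
      (HasCompactSupport.of_compactSpace _) (fun θ => ?_) ?_
    · exact hF.contDiff.continuous.comp (continuous_subtype_val.const_smul R)
    · simp only [Pi.zero_apply, ← mul_assoc]
      by_cases hy : R • (θ : E n) ∈ O'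
      · exact mul_nonneg (le_of_lt hy.2) (h4 ⟨_, rfl⟩).1
      · rw [hψ.eq_zero hy, mul_zero]
    · simp only [hθ0, h5, mul_one]
      exact mul_self_ne_zero.2 hne
  rw [integral_const_mul, hint ψ (hψ.mono le_rfl inter_subset_left), mul_zero] at hpos
  exact hpos.false

theorem theta_mul {a b : E n → ℝ} {x : E n} (ha : DifferentiableAt ℝ a x)
    (hb : DifferentiableAt ℝ b x) :
    theta (fun y => a y * b y) x = a x * theta b x + b x * theta a x := by
  simp only [theta]
  rw [fderiv_fun_mul ha hb]
  rfl

theorem theta_norm_sq_sub (R : ℝ) (x : E n) :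
    theta (fun y => ‖y‖ ^ 2 - R ^ 2) x = 2 * ‖x‖ ^ 2 := by
  have : HasFDerivAt (fun y : E n => ‖y‖ ^ 2) (2 • innerSL ℝ x) x :=
    (hasStrictFDerivAt_norm_sq x).hasFDerivAt
  rw [theta, (this.sub_const (R ^ 2)).fderiv]
  simp

theorem IsTest.theta_eq_zero {k : WithTop ℕ∞} (hw : IsTest k O w) {x : E n} (hx : x ∉ O) :
    theta w x = 0 := by
  rw [theta, image_eq_zero_of_notMem_tsupport (f := fderiv ℝ w)
    fun h => hx (hw.subset (tsupport_fderiv_subset ℝ h))]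
  rfl

theorem bdry_eq_zero (hn : 1 ≤ n) (hR : 0 < R) (hO : IsOpen O) (h0 : (0 : E n) ∉ O)
    {M : Fin n → Fin n → E n → ℝ} (hM : ∀ i j, ContDiffOn ℝ 2 (M i j) O)
    (hdiv : ∀ w, IsTest ∞ O w →
      ∫ x in {x : E n | R < ‖x‖}, ∑ i, pd i (greenField M w i) x = 0)
    {x : E n} (hx : x ∈ O) (hxR : ‖x‖ = R) : bdryV M x = 0 ∧ bdryQ M x = 0 := by
  have hnorm : ∀ θ : Metric.sphere (0 : E n) 1, ‖R • (θ : E n)‖ = R := fun θ => by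
    simp [norm_smul, abs_of_pos hR]
  have hV : ∀ x ∈ O, ‖x‖ = R → bdryV M x = 0 := fun x hx hxR => by
    refine eq_zero_of_integral_sphere hR hO (continuousOn_bdryV hM) (fun ψ hψ => ?_) hx hxR
    have hw : IsTest ∞ O (fun y => (‖y‖ ^ 2 - R ^ 2) * ψ y) :=
      hψ.mul_left hO ((contDiff_norm_sq ℝ).sub contDiff_const).contDiffOn
    have h := integral_sphere_eq_zero hn hR hO h0 hM hw (hdiv _ hw)
    have e : ∀ θ : Metric.sphere (0 : E n) 1, theta (fun y => (‖y‖ ^ 2 - R ^ 2) * ψ y) (R • (θ : E n)) =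
        2 * R ^ 2 * ψ (R • (θ : E n)) := fun θ => by
      rw [theta_mul (((contDiff_norm_sq ℝ (n := 1)).sub contDiff_const).contDiffAt.differentiableAt
        one_ne_zero) (hψ.differentiableAt (by simp) _), theta_norm_sq_sub, hnorm]
      ring
    simp only [e, hnorm, sub_self, zero_mul, mul_zero, sub_zero, mul_left_comm _ (2 * R ^ 2),
      integral_const_mul] at h
    exact (mul_eq_zero.1 h).resolve_left (by positivity)
  refine ⟨hV x hx hxR, ?_⟩
  refine eq_zero_of_integral_sphere hR hO (continuousOn_bdryQ hO hM) (fun ψ hψ => ?_) hx hxR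
  have h := integral_sphere_eq_zero hn hR hO h0 hM hψ (hdiv _ hψ)
  have e : ∀ θ : Metric.sphere (0 : E n) 1, bdryV M (R • (θ : E n)) * theta ψ (R • (θ : E n)) = 0 :=
    fun θ => by
    by_cases hθ : R • (θ : E n) ∈ O
    · rw [hV _ hθ (hnorm θ), zero_mul]
    · rw [hψ.theta_eq_zero hθ, mul_zero]
  simpa only [e, zero_sub, integral_neg, neg_eq_zero] using h

/-- The weighted matrix field `ω_p² (∂_i ∂_j u + (n - 2) δ_{ij} Δ u)`. -/
noncomputable def stress (lam : E n → ℝ) (P p : ℝ) (u : E n → ℝ) (i j : Fin n) (x : E n) : ℝ :=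
  wt lam P (n - p) x * (pd i (pd j u) x + if i = j then ((n : ℝ) - 2) * lap u x else 0)

theorem contDiffOn_pd_pd (hO : IsOpen O) (hu : ContDiffOn ℝ 4 u O) (i j : Fin n) :
    ContDiffOn ℝ 2 (pd i (pd j u)) O :=
  contDiffOn_pd hO (contDiffOn_pd hO hu (m := 3) (by norm_num) j) (by norm_num) i

theorem contDiffOn_lap (hO : IsOpen O) (hu : ContDiffOn ℝ 4 u O) : ContDiffOn ℝ 2 (lap u) O :=
  ContDiffOn.sum fun i _ => contDiffOn_pd_pd hO hu i i

theorem contDiffOn_stress (hK : IsConicalLocalization K lam) (hO : IsOpen O) (hOK : O ⊆ K)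
    (hu : ContDiffOn ℝ 4 u O) (i j : Fin n) : ContDiffOn ℝ 2 (stress lam P p u i j) O := by
  refine ((contDiffOn_wt hK).mono hOK).mul ((contDiffOn_pd_pd hO hu i j).add ?_)
  split_ifs
  · exact contDiffOn_const.mul (contDiffOn_lap hO hu)
  · exact contDiffOn_const

theorem stress_symm (hO : IsOpen O) (hu : ContDiffOn ℝ 4 u O) (i j : Fin n) :
    EqOn (stress lam P p u i j) (stress lam P p u j i) O := by
  intro x hx
  simp only [stress, eq_comm (a := i) (b := j)]
  rw [pd_comm ((hu.contDiffAt (hO.mem_nhds hx)).of_le (by norm_num))]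

theorem hamOp_eq (hK : IsConicalLocalization K lam) (hO : IsOpen O) (hOK : O ⊆ K)
    (hu : ContDiffOn ℝ 4 u O) {x : E n} (hx : x ∈ O) :
    omega lam P p x ^ 2 * hamOp lam P p u x =
      ∑ i, ∑ j, pd i (pd j (stress lam P p u i j)) x := by
  have hW : ContDiffOn ℝ 2 (wt lam P (n - p)) O := (contDiffOn_wt hK).mono hOK
  have hL : ContDiffOn ℝ 2 (fun y => wt lam P (n - p) y * lap u y) O :=
    hW.mul (contDiffOn_lap hO hu)
  have hD : ∀ i j, ContDiffOn ℝ 2 (fun y => wt lam P (n - p) y * pd i (pd j u) y) O :=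
    fun i j => hW.mul (contDiffOn_pd_pd hO hu i j)
  have hω : ∀ y ∈ O, omega lam P p y ^ 2 = wt lam P (n - p) y := fun y hy => omega_sq hK (hOK hy)
  have pd2 : ∀ {a b : E n → ℝ} (i j : Fin n), EqOn a b O → pd i (pd j a) x = pd i (pd j b) x :=
    fun i j h => pd_congr_of_eqOn hO hx (fun y hy => pd_congr_of_eqOn hO hy h j) i
  have e1 : lap (fun y => omega lam P p y ^ 2 * lap u y) x =
      ∑ i, pd i (pd i (fun y => wt lam P (n - p) y * lap u y)) x :=
    Finset.sum_congr rfl fun i _ => pd2 i i fun y hy => by simp only [hω y hy]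
  have e2 : ∀ i j, pd i (pd j (fun y => omega lam P p y ^ 2 * pd i (pd j u) y)) x =
      pd i (pd j (fun y => wt lam P (n - p) y * pd i (pd j u) y)) x :=
    fun i j => pd2 i j fun y hy => by simp only [hω y hy]
  have e3 : ∀ i j, pd i (pd j (stress lam P p u i j)) x =
      pd i (pd j (fun y => wt lam P (n - p) y * pd i (pd j u) y)) x + if i = j then
        ((n : ℝ) - 2) * pd i (pd i (fun y => wt lam P (n - p) y * lap u y)) x else 0 := by
    intro i j
    by_cases hij : i = j
    · subst hij
      have h1 : stress lam P p u i i = fun y => wt lam P (n - p) y * pd i (pd i u) y +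
          ((n : ℝ) - 2) * (wt lam P (n - p) y * lap u y) := by
        ext y
        simp only [stress, if_true]
        ring
      have h2 : ∀ y ∈ O, pd i (stress lam P p u i i) y =
          pd i (fun y => wt lam P (n - p) y * pd i (pd i u) y) y +
            ((n : ℝ) - 2) * pd i (fun y => wt lam P (n - p) y * lap u y) y := by
        intro y hy
        rw [h1, pd_add (differentiableAt_of_contDiffOn hO (hD i i) (by norm_num) hy)
          ((differentiableAt_of_contDiffOn hO hL (by norm_num) hy).const_mul _), pd_const_mul]
      rw [pd_congr_of_eqOn hO hx h2, pd_add (differentiableAt_of_contDiffOn hO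
        (contDiffOn_pd hO (hD i i) one_add_one_le_two i) le_rfl hx) ((differentiableAt_of_contDiffOn hO
        (contDiffOn_pd hO hL one_add_one_le_two i) le_rfl hx).const_mul _), pd_const_mul, if_pos rfl]
    · have h1 : stress lam P p u i j = fun y => wt lam P (n - p) y * pd i (pd j u) y := by
        ext y
        simp only [stress, if_neg hij, add_zero]
      rw [h1, if_neg hij, add_zero]
  have hpos : omega lam P p x ^ 2 ≠ 0 := by
    rw [hω x hx]
    exact (wt_pos hK (hOK hx)).ne'
  rw [hamOp, mul_inv_cancel_left₀ hpos, e1]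
  simp only [e2, e3, Finset.sum_add_distrib, Finset.sum_ite_eq, Finset.mem_univ, if_true,
    ← Finset.mul_sum]
  ring

theorem sum_adjH_mul_adjH (D D' : Fin n → Fin n → E n → ℝ) (x : E n) :
    ∑ i, ∑ j, adjH D' i j x * adjH D i j x =
      ∑ i, ∑ j, (D i j x + if i = j then ((n : ℝ) - 2) * ∑ k, D k k x else 0) * D' i j x := by
  have e1 : ∀ i j, adjH D' i j x * adjH D i j x = D i j x * D' i j x + if i = j then
      (∑ k, D' k k x) * (∑ k, D k k x) - (∑ k, D' k k x) * D i j x -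
        (∑ k, D k k x) * D' i j x else 0 := by
    intro i j
    simp only [adjH]
    split_ifs <;> ring
  have e2 : ∀ i j, (D i j x + if i = j then ((n : ℝ) - 2) * ∑ k, D k k x else 0) * D' i j x =
      D i j x * D' i j x + if i = j then ((n : ℝ) - 2) * (∑ k, D k k x) * D' i j x else 0 := by
    intro i j
    split_ifs <;> ring
  simp only [e1, e2, Finset.sum_add_distrib, Finset.sum_ite_eq, Finset.mem_univ, if_true,
    Finset.sum_sub_distrib, ← Finset.mul_sum, Finset.sum_const, Finset.card_univ, Fintype.card_fin,
    nsmul_eq_mul]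
  ring

theorem setIntegral_Om_eq {g : E n → ℝ}
    (hg : ∀ x ∉ K, g x = 0) : ∫ x in Om K R, g x = ∫ x in {x : E n | R < ‖x‖}, g x := by
  refine (setIntegral_eq_of_subset_of_forall_sdiff_eq_zero
    (isOpen_lt continuous_const continuous_norm).measurableSet inter_subset_right fun x hx => ?_).symm
  exact hg x fun hxK => hx.2 ⟨hxK, hx.1⟩

theorem integral_greenField_add (hK : IsConicalLocalization K lam) (hO : IsOpen O) (hOK : O ⊆ K)
    (hOm : Om K R ⊆ O) (hu : ContDiffOn ℝ 4 u O) (hvar : IsVariationalSolution K lam P R p f u)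
    (hw : IsTest ∞ O w) :
    ∫ x in Om K R, (∑ i, pd i (greenField (stress lam P p u) w i) x +
      (∑ i, ∑ j, pd i (pd j (stress lam P p u i j)) x) * w x) =
      ∫ x in Om K R, w x * f x * omega lam P p x ^ 2 := by
  obtain ⟨G, D, hH2, h⟩ := hvar
  have hm : MeasurableSet (Om K R) := hK.isOpen_Om.measurableSet
  rw [← h w _ _ (hw.mono le_rfl hOK |>.isH2With hK)]
  have hD : ∀ᵐ x, ∀ i j, x ∈ Om K R → D i j x = pd i (pd j u) x :=
    ae_all_iff.2 fun i => ae_all_iff.2 fun j => hH2.hess_ae_eq hK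
      ((hu.mono hOm).of_le (by norm_num)) i j
  refine setIntegral_congr_ae hm ?_
  filter_upwards [hD] with x hx hxO
  rw [div_greenField hO (contDiffOn_stress hK hO hOK hu) (stress_symm hO hu) hw (hOm hxO),
    sub_add_cancel, sum_adjH_mul_adjH, omega_sq hK hxO.1, Finset.sum_mul]
  refine Finset.sum_congr rfl fun i _ => ?_
  rw [Finset.sum_mul]
  refine Finset.sum_congr rfl fun j _ => ?_
  simp only [stress, lap, hx _ _ hxO]
  ring

theorem contDiffOn_div_stress (hK : IsConicalLocalization K lam) (hO : IsOpen O) (hOK : O ⊆ K)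
    (hu : ContDiffOn ℝ 4 u O) :
    ContDiffOn ℝ 0 (fun x => ∑ i, ∑ j, pd i (pd j (stress lam P p u i j)) x) O :=
  ContDiffOn.sum fun i _ => ContDiffOn.sum fun j _ => contDiffOn_pd hO
    (contDiffOn_pd hO (contDiffOn_stress hK hO hOK hu i j) one_add_one_le_two j) (by simp) i

theorem isTest_div_greenField (hK : IsConicalLocalization K lam) (hO : IsOpen O) (hOK : O ⊆ K)
    (hu : ContDiffOn ℝ 4 u O) (hw : IsTest ∞ O w) :
    IsTest 0 O (fun x => ∑ i, pd i (greenField (stress lam P p u) w i) x) :=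
  IsTest.sum _ fun i _ =>
    (isTest_greenField hO (contDiffOn_stress hK hO hOK hu) hw i).pderiv (by simp) i

theorem IsTest.setIntegral_Om_eq {g : E n → ℝ} {k : WithTop ℕ∞} (hg : IsTest k (Om K R) g) :
    ∫ x in Om K R, g x = ∫ x, g x :=
  setIntegral_eq_integral_of_forall_compl_eq_zero fun _ hx => hg.eq_zero hx

theorem hamOp_ae_eq (hK : IsConicalLocalization K lam) (hO : IsOpen O) (hOK : O ⊆ K)
    (hOm : Om K R ⊆ O) (hu : ContDiffOn ℝ 4 u O) (hvar : IsVariationalSolution K lam P R p f u)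
    {q : ℝ} (hf : MemWL2 K lam P R q f) : ∀ᵐ x, x ∈ Om K R → hamOp lam P p u x = f x := by
  have hOmO := hK.isOpen_Om (R := R)
  have hWc : ContinuousOn (wt lam P (n - p)) (Om K R) :=
    (contDiffOn_wt hK).continuousOn.mono inter_subset_left
  have hHc := (contDiffOn_div_stress (P := P) (p := p) hK hO hOK hu).continuousOn.mono hOm
  have hlf : LocallyIntegrableOn (fun x => wt lam P (n - p) x * f x) (Om K R) :=
    (hf.locallyIntegrableOn hK).continuousOn_mul hWc hOmO.isLocallyClosed
  have hlH := hHc.locallyIntegrableOn (μ := volume) hOmO.measurableSet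
  have main := hOmO.ae_eq_zero_of_integral_contDiff_smul_eq_zero (hlf.sub hlH) fun ψ h1 h3 h4 => ?_
  · filter_upwards [main] with x hx hxO
    have h := hx hxO
    simp only [Pi.sub_apply] at h
    rw [← hamOp_eq hK hO hOK hu (hOm hxO), omega_sq hK hxO.1, ← mul_sub] at h
    exact (sub_eq_zero.1 ((mul_eq_zero.1 h).resolve_left (wt_pos hK hxO.1).ne')).symm
  · have hψ : IsTest ∞ (Om K R) ψ := ⟨h1, h3, h4⟩
    have h := integral_greenField_add hK hO hOK hOm hu hvar (hψ.mono le_rfl hOm)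
    have hg := isTest_div_greenField (P := P) (p := p) hK hOmO inter_subset_left (hu.mono hOm) hψ
    have hHψ : IsTest 0 (Om K R) (fun x =>
      (∑ i, ∑ j, pd i (pd j (stress lam P p u i j)) x) * ψ x) :=
      (hψ.mono (by simp) le_rfl).mul_left hOmO (contDiffOn_div_stress hK hOmO inter_subset_left
        (hu.mono hOm))
    have hzero : ∫ x, ∑ i, pd i (greenField (stress lam P p u) ψ i) x = 0 := by
      have hY := isTest_greenField hOmO
        (contDiffOn_stress (P := P) (p := p) hK hOmO inter_subset_left (hu.mono hOm)) hψ
      rw [integral_finsetSum _ fun i _ => ((hY i).pderiv (m := 0) (by simp) i).integrable]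
      exact Finset.sum_eq_zero fun i _ => (hY i).integral_pd_eq_zero le_rfl i
    rw [(hg.add hHψ).setIntegral_Om_eq, integral_add hg.integrable hHψ.integrable, hzero,
      zero_add] at h
    have hint : Integrable fun x => (wt lam P (n - p) x * f x) * ψ x := by
      have hs : IntegrableOn (fun x => (wt lam P (n - p) x * f x) * ψ x) (tsupport ψ) :=
        (hlf.integrableOn_compact_subset hψ.subset hψ.compact).mul_continuousOn
          hψ.contDiff.continuous.continuousOn hψ.compact
      rwa [integrableOn_iff_integrable_of_support_subset] at hs
      intro x hx
      by_contra hx'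
      exact hx (by simp [image_eq_zero_of_notMem_tsupport hx'])
    have e : ∫ x in Om K R, ψ x * f x * omega lam P p x ^ 2 =
        ∫ x, (wt lam P (n - p) x * f x) * ψ x := by
      have e0 : ∫ x, (wt lam P (n - p) x * f x) * ψ x =
          ∫ x in Om K R, (wt lam P (n - p) x * f x) * ψ x :=
        (setIntegral_eq_integral_of_forall_compl_eq_zero fun x hx => by
          rw [hψ.eq_zero hx, mul_zero]).symm
      rw [e0]
      refine setIntegral_congr_fun hOmO.measurableSet fun x hx => ?_
      simp only [omega_sq hK hx.1]
      ring
    rw [e] at h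
    simp only [Pi.sub_apply, smul_eq_mul, mul_comm (ψ _), sub_mul]
    rw [integral_sub hint hHψ.integrable, h, sub_self]

theorem bdry_stress_eq_zero (hn : 1 ≤ n) (hR : 0 < R) (hK : IsConicalLocalization K lam)
    (hO : IsOpen O) (hOK : O ⊆ K) (hOm : Om K R ⊆ O) (hu : ContDiffOn ℝ 4 u O)
    (hvar : IsVariationalSolution K lam P R p f u) {q : ℝ} (hf : MemWL2 K lam P R q f)
    {x : E n} (hx : x ∈ O) (hxR : ‖x‖ = R) :
    bdryV (stress lam P p u) x = 0 ∧ bdryQ (stress lam P p u) x = 0 := by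
  refine bdry_eq_zero hn hR hO (fun h => hK.zero_notMem (hOK h)) (contDiffOn_stress hK hO hOK hu)
    (fun w hw => ?_) hx hxR
  have hg := isTest_div_greenField (P := P) (p := p) hK hO hOK hu hw
  have hHw : IsTest 0 O (fun x => (∑ i, ∑ j, pd i (pd j (stress lam P p u i j)) x) * w x) :=
    (hw.mono (by simp) le_rfl).mul_left hO (contDiffOn_div_stress hK hO hOK hu)
  have h := integral_greenField_add hK hO hOK hOm hu hvar hw
  rw [integral_add hg.integrable.integrableOn hHw.integrable.integrableOn] at h
  have e : ∫ x in Om K R, w x * f x * omega lam P p x ^ 2 =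
      ∫ x in Om K R, (∑ i, ∑ j, pd i (pd j (stress lam P p u i j)) x) * w x := by
    refine setIntegral_congr_ae hK.isOpen_Om.measurableSet ?_
    filter_upwards [hamOp_ae_eq hK hO hOK hOm hu hvar hf] with x hx hxO
    rw [← hamOp_eq hK hO hOK hu (hOm hxO), hx hxO]
    ring
  rw [e, add_eq_right, setIntegral_Om_eq fun x hx => hg.eq_zero fun h => hx (hOK h)] at h
  exact h

end LocHam

namespace LocHam

open Set
open scoped NNReal

variable {n : ℕ} {K : Set (E n)} {lam : E n → ℝ} {P R p : ℝ} {O : Set (E n)} {f u w : E n → ℝ}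

theorem theta_eq (f : E n → ℝ) : theta f = fun x => ∑ i, x i * pd i f x :=
  funext (theta_eq_sum f)

theorem contDiffOn_theta {k m : WithTop ℕ∞} (hO : IsOpen O) (hf : ContDiffOn ℝ k f O)
    (hm : m + 1 ≤ k) : ContDiffOn ℝ m (theta f) O :=
  (hf.fderiv_of_isOpen hO hm).clm_apply contDiffOn_id

theorem theta_congr_of_eqOn {f g : E n → ℝ} (hO : IsOpen O) {x : E n} (hx : x ∈ O)
    (h : EqOn f g O) : theta f x = theta g x := by
  rw [theta, (h.eventuallyEq_of_mem (hO.mem_nhds hx)).fderiv_eq, theta]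

theorem theta_add {a b : E n → ℝ} {x : E n} (ha : DifferentiableAt ℝ a x)
    (hb : DifferentiableAt ℝ b x) : theta (fun y => a y + b y) x = theta a x + theta b x := by
  simp only [theta]
  rw [fderiv_fun_add ha hb]
  rfl

theorem theta_sub {a b : E n → ℝ} {x : E n} (ha : DifferentiableAt ℝ a x)
    (hb : DifferentiableAt ℝ b x) : theta (fun y => a y - b y) x = theta a x - theta b x := by
  simp only [theta]
  rw [fderiv_fun_sub ha hb]
  rfl

theorem theta_const_mul (a : E n → ℝ) (c : ℝ) (x : E n) :
    theta (fun y => c * a y) x = c * theta a x := by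
  simp only [theta_eq_sum, pd_const_mul, Finset.mul_sum]
  exact Finset.sum_congr rfl fun i _ => by ring

theorem theta_sum {ι : Type*} {s : Finset ι} {F : ι → E n → ℝ} {x : E n}
    (hF : ∀ k ∈ s, DifferentiableAt ℝ (F k) x) :
    theta (fun y => ∑ k ∈ s, F k y) x = ∑ k ∈ s, theta (F k) x := by
  simp only [theta]
  rw [fderiv_fun_sum hF]
  simp

theorem theta_coord (i : Fin n) (x : E n) : theta (fun y => y i) x = x i := by
  simp [theta_eq_sum, pd_coord]

theorem theta_norm_sq (x : E n) : theta (fun y => ‖y‖ ^ 2) x = 2 * ‖x‖ ^ 2 := by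
  simpa using theta_norm_sq_sub 0 x

theorem differentiableAt_norm {x : E n} (hx : x ≠ 0) : DifferentiableAt ℝ (fun y : E n => ‖y‖) x :=
  (contDiffAt_norm ℝ hx (n := 1)).differentiableAt one_ne_zero

theorem differentiableAt_norm_sq (x : E n) : DifferentiableAt ℝ (fun y : E n => ‖y‖ ^ 2) x :=
  (contDiff_norm_sq ℝ (n := 1)).contDiffAt.differentiableAt one_ne_zero

theorem pd_norm {x : E n} (hx : x ≠ 0) (i : Fin n) : pd i (fun y => ‖y‖) x = x i / ‖x‖ := by
  have h := pd_norm_sq i x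
  simp only [sq] at h
  rw [pd_mul (differentiableAt_norm hx) (differentiableAt_norm hx)] at h
  have : ‖x‖ ≠ 0 := norm_ne_zero_iff.2 hx
  field_simp
  linarith

theorem pd_norm_rpow {x : E n} (hx : x ≠ 0) (s : ℝ) (i : Fin n) :
    pd i (fun y => ‖y‖ ^ s) x = s * ‖x‖ ^ (s - 1) * (x i / ‖x‖) := by
  have h := (differentiableAt_norm hx).hasFDerivAt.rpow_const (p := s)
    (Or.inl (norm_ne_zero_iff.2 hx))
  rw [pd, h.fderiv, ← pd_norm hx]
  simp [pd]

theorem pd_norm_inv {x : E n} (hx : x ≠ 0) (i : Fin n) :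
    pd i (fun y => ‖y‖⁻¹) x = -(x i / ‖x‖ ^ 3) := by
  have h := pd_norm_rpow hx (-1) i
  simp only [Real.rpow_neg_one] at h
  rw [h, show (-1 - 1 : ℝ) = ((-2 : ℤ) : ℝ) by norm_num, Real.rpow_intCast]
  have : ‖x‖ ≠ 0 := norm_ne_zero_iff.2 hx
  field_simp

theorem theta_of_homogeneous {h : E n → ℝ} {x : E n} {m : ℝ} (hd : DifferentiableAt ℝ h x)
    (hh : ∀ t : ℝ, 0 < t → h (t • x) = t ^ m * h x) : theta h x = m * h x := by
  have h1 : HasDerivAt (fun t : ℝ => t • x) x 1 := by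
    simpa using (hasDerivAt_id (1 : ℝ)).smul_const x
  have hd' : HasFDerivAt h (fderiv ℝ h x) ((1 : ℝ) • x) := by simpa using hd.hasFDerivAt
  have h2 : HasDerivAt (fun t : ℝ => h (t • x)) (theta h x) 1 := hd'.comp_hasDerivAt 1 h1
  have h3 : HasDerivAt (fun t : ℝ => t ^ m * h x) (m * h x) 1 := by
    simpa using (Real.hasDerivAt_rpow_const (x := 1) (p := m) (Or.inl one_ne_zero)).mul_const (h x)
  refine h2.unique (h3.congr_of_eventuallyEq ?_)
  filter_upwards [eventually_gt_nhds (zero_lt_one (α := ℝ))] with t ht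
  exact hh t ht

theorem pd_theta {x : E n} (hf : ContDiffAt ℝ 2 f x) (j : Fin n) :
    pd j (theta f) x = pd j f x + theta (pd j f) x := by
  have hd : ∀ i, DifferentiableAt ℝ (pd i f) x := fun i =>
    ((hf.fderiv_right (m := 1) (by norm_num)).clm_apply contDiffAt_const).differentiableAt one_ne_zero
  have hd' : ∀ i, DifferentiableAt ℝ (fun y : E n => y i * pd i f y) x := fun i =>
    (differentiableAt_coord i x).mul (hd i)
  rw [theta_eq, pd_sum fun i _ => hd' i, theta_eq_sum]
  simp only [pd_mul (differentiableAt_coord _ x) (hd _), pd_coord, Finset.sum_add_distrib,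
    mul_ite, mul_one, mul_zero, Finset.sum_ite_eq, Finset.mem_univ, if_true, pd_comm hf j]
  ring

theorem lap_theta (hO : IsOpen O) (hf : ContDiffOn ℝ 3 f O) {x : E n} (hx : x ∈ O) :
    lap (theta f) x = theta (lap f) x + 2 * lap f x := by
  have hf2 : ∀ y ∈ O, ContDiffAt ℝ 2 f y := fun y hy =>
    (hf.contDiffAt (hO.mem_nhds hy)).of_le (by norm_num)
  have h1 : ∀ j, ContDiffOn ℝ 2 (pd j f) O := fun j => contDiffOn_pd hO hf (by norm_num) j
  have h2 : ∀ i j, DifferentiableAt ℝ (pd i (pd j f)) x := fun i j =>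
    differentiableAt_of_contDiffOn hO (contDiffOn_pd hO (h1 j) one_add_one_le_two i) le_rfl hx
  have e : ∀ j, pd j (pd j (theta f)) x = 2 * pd j (pd j f) x + theta (pd j (pd j f)) x := by
    intro j
    rw [pd_congr_of_eqOn hO hx fun y hy => pd_theta (hf2 y hy) j,
      pd_add (differentiableAt_of_contDiffOn hO (h1 j) (by norm_num) hx)
      (differentiableAt_of_contDiffOn hO (contDiffOn_theta hO (h1 j) one_add_one_le_two) le_rfl hx),
      pd_theta ((h1 j).contDiffAt (hO.mem_nhds hx))]
    ring
  change ∑ j, pd j (pd j (theta f)) x = theta (fun y => ∑ j, pd j (pd j f) y) x +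
    2 * ∑ j, pd j (pd j f) x
  rw [theta_sum fun j _ => h2 j j]
  simp only [e, Finset.sum_add_distrib, Finset.mul_sum]
  ring

theorem sum_dsl_mul_dsl {x : E n} (hx : x ≠ 0) (a b : E n → ℝ) :
    ∑ i, dsl i a x * dsl i b x = ‖x‖ ^ 2 * ∑ i, pd i a x * pd i b x - theta a x * theta b x := by
  have hr : ‖x‖ ≠ 0 := norm_ne_zero_iff.2 hx
  have e : ∀ i, dsl i a x * dsl i b x = ‖x‖ ^ 2 * (pd i a x * pd i b x) -
      theta b x * (x i * pd i a x) - theta a x * (x i * pd i b x) +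
        (theta a x * theta b x / ‖x‖ ^ 2) * (x i * x i) := fun i => by
    simp only [dsl]
    field_simp
    ring
  have hr2 : ∑ i, x i * x i = ‖x‖ ^ 2 := by
    rw [EuclideanSpace.real_norm_sq_eq]
    simp only [sq]
  simp only [e, Finset.sum_add_distrib, Finset.sum_sub_distrib, ← Finset.mul_sum, ← theta_eq_sum,
    hr2]
  field_simp
  ring

theorem dsl_mul {a b : E n → ℝ} {x : E n} (ha : DifferentiableAt ℝ a x)
    (hb : DifferentiableAt ℝ b x) (i : Fin n) :
    dsl i (fun y => a y * b y) x = a x * dsl i b x + b x * dsl i a x := by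
  rw [dsl, pd_mul ha hb, theta_mul ha hb, dsl, dsl]
  ring

theorem dsl_sub {a b : E n → ℝ} {x : E n} (ha : DifferentiableAt ℝ a x)
    (hb : DifferentiableAt ℝ b x) (i : Fin n) :
    dsl i (fun y => a y - b y) x = dsl i a x - dsl i b x := by
  rw [dsl, pd_sub ha hb, theta_sub ha hb, dsl, dsl]
  ring

theorem dsl_eq_zero_of_radial {c : E n → ℝ} {x : E n} (hx : x ≠ 0) {κ : ℝ}
    (h : ∀ i, pd i c x = κ * x i) (i : Fin n) : dsl i c x = 0 := by
  have hr : ‖x‖ ≠ 0 := norm_ne_zero_iff.2 hx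
  have hθ : theta c x = κ * ‖x‖ ^ 2 := by
    rw [theta_eq_sum, EuclideanSpace.real_norm_sq_eq, Finset.mul_sum]
    exact Finset.sum_congr rfl fun j _ => by rw [h]; ring
  rw [dsl, h, hθ]
  field_simp
  ring

theorem sum_coord_mul_dsl {x : E n} (hx : x ≠ 0) (f : E n → ℝ) : ∑ i, x i * dsl i f x = 0 := by
  have hr : ‖x‖ ≠ 0 := norm_ne_zero_iff.2 hx
  have e : ∀ i, x i * dsl i f x = ‖x‖ * (x i * pd i f x) - theta f x / ‖x‖ * (x i ^ 2) := fun i => by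
    rw [dsl]
    ring
  simp only [e, Finset.sum_sub_distrib, ← Finset.mul_sum, ← theta_eq_sum,
    ← EuclideanSpace.real_norm_sq_eq]
  field_simp
  ring

theorem lapS_eq (hO : IsOpen O) (h0 : (0 : E n) ∉ O) (hf : ContDiffOn ℝ 2 f O) {x : E n}
    (hx : x ∈ O) :
    lapS f x = ‖x‖ ^ 2 * lap f x - theta (theta f) x - ((n : ℝ) - 2) * theta f x := by
  have hx0 : x ≠ 0 := fun h => h0 (h ▸ hx)
  have hr : ‖x‖ ≠ 0 := norm_ne_zero_iff.2 hx0
  have dn := differentiableAt_norm hx0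
  have dni : DifferentiableAt ℝ (fun y : E n => ‖y‖⁻¹) x := dn.inv hr
  have dp : ∀ i, DifferentiableAt ℝ (pd i f) x := fun i =>
    differentiableAt_of_contDiffOn hO (contDiffOn_pd hO hf one_add_one_le_two i) le_rfl hx
  have dθ : DifferentiableAt ℝ (theta f) x :=
    differentiableAt_of_contDiffOn hO (contDiffOn_theta hO hf one_add_one_le_two) le_rfl hx
  have dx : ∀ i, DifferentiableAt ℝ (fun y : E n => y i * (‖y‖⁻¹ * theta f y)) x := fun i =>
    (differentiableAt_coord i x).mul (dni.mul dθ)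
  have dm : DifferentiableAt ℝ (fun y => ‖y‖⁻¹ * theta f y) x := dni.mul dθ
  have dnp : ∀ i, DifferentiableAt ℝ (fun y => ‖y‖ * pd i f y) x := fun i => dn.mul (dp i)
  have dxp : ∀ i, DifferentiableAt ℝ (fun y : E n => y i * pd i f y) x := fun i =>
    (differentiableAt_coord i x).mul (dp i)
  have e : ∀ i, dsl i (dsl i f) x = ‖x‖ * dsl i (pd i f) x -
      (‖x‖⁻¹ * (x i * dsl i (theta f) x) + ‖x‖⁻¹ * theta f x * dsl i (fun y => y i) x) := by
    intro i
    have e1 : dsl i f = fun y => ‖y‖ * pd i f y - y i * (‖y‖⁻¹ * theta f y) := by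
      ext y
      rw [dsl]
      ring
    rw [e1, dsl_sub (dnp i) (dx i), dsl_mul dn (dp i),
      dsl_mul (differentiableAt_coord i x) dm, dsl_mul dni dθ,
      dsl_eq_zero_of_radial (c := fun y => ‖y‖) hx0 (κ := ‖x‖⁻¹) fun j => by rw [pd_norm hx0]; ring,
      dsl_eq_zero_of_radial (c := fun y => ‖y‖⁻¹) hx0 (κ := -(‖x‖ ^ 3)⁻¹) fun j => by
        rw [pd_norm_inv hx0]; ring]
    ring
  have e2 : ∀ i, dsl i (fun y => y i) x = ‖x‖ - x i ^ 2 / ‖x‖ := fun i => by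
    rw [dsl, pd_coord, theta_coord]
    simp
    ring
  have e3 : ∑ i, x i * theta (pd i f) x = theta (theta f) x - theta f x := by
    have : theta (theta f) x = ∑ i, theta (fun y => y i * pd i f y) x := by
      rw [← theta_sum fun i _ => dxp i, ← theta_eq]
    rw [this]
    simp only [theta_mul (differentiableAt_coord _ x) (dp _), theta_coord, Finset.sum_add_distrib,
      mul_comm (pd _ f x), ← theta_eq_sum]
    ring
  have e4 : ∀ i, ‖x‖ * dsl i (pd i f) x = ‖x‖ ^ 2 * pd i (pd i f) x - x i * theta (pd i f) x :=
    fun i => by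
    rw [dsl]
    field_simp
  rw [lapS, divS]
  simp only [e, e2, e4, Finset.sum_sub_distrib, Finset.sum_add_distrib, ← Finset.mul_sum, e3,
    sum_coord_mul_dsl hx0, ← Finset.sum_div, ← EuclideanSpace.real_norm_sq_eq, Finset.sum_const,
    Finset.card_univ, Fintype.card_fin, nsmul_eq_mul, lap]
  field_simp
  ring

theorem bdryQ_eq (hO : IsOpen O) {M : Fin n → Fin n → E n → ℝ}
    (hM : ∀ i j, ContDiffOn ℝ 2 (M i j) O) {x : E n} (hx : x ∈ O) :
    bdryQ M x = 2 * ‖x‖ ^ 2 * ∑ j, pd j (radialRow M j) x - ‖x‖ ^ 2 * ∑ i, M i i x +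
      (2 - n) * bdryV M x - theta (bdryV M) x := by
  have dM : ∀ i j, DifferentiableAt ℝ (M i j) x := fun i j =>
    differentiableAt_of_contDiffOn hO (hM i j) (by norm_num) hx
  have dV : ∀ j, DifferentiableAt ℝ (radialRow M j) x := fun j =>
    differentiableAt_of_contDiffOn hO (contDiffOn_radialRow hM j) (by norm_num) hx
  have dxV : ∀ i j, DifferentiableAt ℝ (fun y : E n => y i * radialRow M j y) x := fun i j =>
    (differentiableAt_coord i x).mul (dV j)
  have dMx : ∀ i j, DifferentiableAt ℝ (fun y : E n => M i j y * y i) x := fun i j =>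
    (dM i j).mul (differentiableAt_coord i x)
  have e1 : ∑ i, ∑ j, x i * pd j (M i j) x = ∑ j, pd j (radialRow M j) x - ∑ i, M i i x := by
    have : ∀ j, pd j (radialRow M j) x = ∑ i, x i * pd j (M i j) x + M j j x := by
      intro j
      change pd j (fun y => ∑ i, M i j y * y i) x = _
      rw [pd_sum fun i _ => dMx i j]
      simp [pd_mul (dM _ j) (differentiableAt_coord _ x), pd_coord, Finset.sum_add_distrib,
        add_comm]
    simp only [this, Finset.sum_add_distrib]
    rw [Finset.sum_comm]
    ring
  have e2 : ∀ i j, x i * pd j (fun y => y i * radialRow M j y - y j * radialRow M i y) x =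
      x i * x i * pd j (radialRow M j) x + (if j = i then x i * radialRow M j x else 0) -
        x i * (x j * pd j (radialRow M i) x) - x i * radialRow M i x := by
    intro i j
    rw [pd_sub (dxV i j) (dxV j i), pd_mul (differentiableAt_coord i x) (dV j),
      pd_mul (differentiableAt_coord j x) (dV i), pd_coord, pd_coord, if_pos rfl]
    split_ifs <;> ring
  have e3 : theta (bdryV M) x = ∑ i, x i * theta (radialRow M i) x + bdryV M x := by
    change theta (fun y => ∑ j, y j * radialRow M j y) x = _ + ∑ j, x j * radialRow M j x
    rw [theta_sum fun j _ => dxV j j]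
    simp only [theta_mul (differentiableAt_coord _ x) (dV _), theta_coord, Finset.sum_add_distrib,
      mul_comm (radialRow M _ x)]
  have e4 : ∑ i, ∑ j, x i * x i * pd j (radialRow M j) x =
      ‖x‖ ^ 2 * ∑ j, pd j (radialRow M j) x := by
    rw [EuclideanSpace.real_norm_sq_eq, Finset.sum_mul_sum]
    simp only [sq]
  have e5 : ∑ i, ∑ j, x i * (x j * pd j (radialRow M i) x) = ∑ i, x i * theta (radialRow M i) x := by
    simp only [← Finset.mul_sum, ← theta_eq_sum]
  rw [bdryQ, e1, e3]
  simp only [e2, Finset.sum_add_distrib, Finset.sum_sub_distrib]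
  rw [e4, e5]
  simp only [Finset.sum_ite_eq', Finset.mem_univ, if_true, Finset.sum_const, Finset.card_univ,
    Fintype.card_fin, nsmul_eq_mul, ← Finset.mul_sum]
  rw [bdryV]
  ring

end LocHam

namespace LocHam

open Set
open scoped NNReal

variable {n : ℕ} {K : Set (E n)} {lam : E n → ℝ} {P R p : ℝ} {O : Set (E n)} {f u w : E n → ℝ}

theorem radialRow_stress (hO : IsOpen O) (hu : ContDiffOn ℝ 4 u O) (j : Fin n) {x : E n}
    (hx : x ∈ O) : radialRow (stress lam P p u) j x = wt lam P (n - p) x *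
      (pd j (fun y => theta u y - u y) x + ((n : ℝ) - 2) * (lap u x * x j)) := by
  have h2 : ContDiffAt ℝ 2 u x := (hu.contDiffAt (hO.mem_nhds hx)).of_le (by norm_num)
  have e1 : pd j (fun y => theta u y - u y) x = ∑ i, x i * pd i (pd j u) x := by
    rw [pd_sub (differentiableAt_of_contDiffOn hO (contDiffOn_theta hO hu (m := 3) (by norm_num))
      (by norm_num) hx) (h2.differentiableAt two_ne_zero), pd_theta h2, theta_eq_sum]
    ring
  rw [e1, mul_add, Finset.mul_sum, radialRow]
  simp only [stress, mul_add, add_mul, Finset.sum_add_distrib, mul_ite, ite_mul, mul_zero, zero_mul,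
    Finset.sum_ite_eq', Finset.mem_univ, if_true]
  congr 1
  · exact Finset.sum_congr rfl fun i _ => by ring
  · ring

theorem bdryV_stress (hO : IsOpen O) (hu : ContDiffOn ℝ 4 u O) {x : E n} (hx : x ∈ O) :
    bdryV (stress lam P p u) x = wt lam P (n - p) x *
      (theta (fun y => theta u y - u y) x + ((n : ℝ) - 2) * (‖x‖ ^ 2 * lap u x)) := by
  rw [bdryV, theta_eq_sum, EuclideanSpace.real_norm_sq_eq]
  simp only [radialRow_stress hO hu _ hx, mul_add, Finset.mul_sum, Finset.sum_mul,
    Finset.sum_add_distrib]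
  congr 1
  · exact Finset.sum_congr rfl fun i _ => by ring
  · exact Finset.sum_congr rfl fun i _ => by ring

theorem sum_stress_diag (x : E n) : ∑ i, stress lam P p u i i x =
    wt lam P (n - p) x * (((n : ℝ) - 1) ^ 2 * lap u x) := by
  simp only [stress, if_true, mul_add, Finset.sum_add_distrib, ← Finset.mul_sum, Finset.sum_const,
    Finset.card_univ, Fintype.card_fin, nsmul_eq_mul]
  rw [← lap]
  ring

theorem theta_wt (hK : IsConicalLocalization K lam) {q : ℝ} {x : E n} (hx : x ∈ K) :
    theta (wt lam P q) x = (2 * q - n) * wt lam P q x :=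
  theta_of_homogeneous (differentiableAt_of_contDiffOn hK.isOpen (contDiffOn_wt hK) (by norm_num) hx)
    fun _ ht => wt_smul hK hx ht

theorem wt_half (x : E n) : wt lam P (n / 2) x = lam x ^ (2 * P) := by
  rw [wt, show 2 * ((n : ℝ) / 2) - n = 0 by ring, Real.rpow_zero, one_mul]

theorem sum_pd_wt_mul (hK : IsConicalLocalization K lam) (g : E n → ℝ) {q : ℝ} {x : E n}
    (hx : x ∈ K) : ‖x‖ ^ 2 * ∑ j, pd j (wt lam P q) x * pd j g x =
      wt lam P q x * ((2 * q - n) * theta g x + (lam x ^ (2 * P))⁻¹ *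
        (‖x‖ ^ 2 * ∑ j, pd j (wt lam P (n / 2)) x * pd j g x)) := by
  have hx0 := hK.ne_zero hx
  have hr : 0 < ‖x‖ := norm_pos_iff.2 hx0
  have hl : 0 < lam x ^ (2 * P) := Real.rpow_pos_of_pos (hK.pos x hx) _
  have e0 : wt lam P q = fun y => ‖y‖ ^ (2 * q - n) * wt lam P (n / 2) y := by
    ext y
    rw [wt_half, wt]
  have dρ : DifferentiableAt ℝ (fun y : E n => ‖y‖ ^ (2 * q - n)) x :=
    (differentiableAt_norm hx0).rpow_const (Or.inl hr.ne')
  have dμ : DifferentiableAt ℝ (wt lam P (n / 2)) x :=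
    differentiableAt_of_contDiffOn hK.isOpen (contDiffOn_wt hK) (by norm_num) hx
  have hs : ‖x‖ ^ (2 * q - n - 1) = ‖x‖ ^ (2 * q - n) / ‖x‖ := Real.rpow_sub_one hr.ne' _
  have e1 : ∀ j, pd j (wt lam P q) x * pd j g x =
      ‖x‖ ^ (2 * q - n) * (pd j (wt lam P (n / 2)) x * pd j g x) +
        (lam x ^ (2 * P) * ((2 * q - n) * ‖x‖ ^ (2 * q - n) / ‖x‖ ^ 2)) * (x j * pd j g x) := by
    intro j
    rw [e0, pd_mul dρ dμ, pd_norm_rpow hx0, hs, wt_half]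
    field_simp
  simp only [e1, Finset.sum_add_distrib, ← Finset.mul_sum, ← theta_eq_sum]
  rw [wt]
  field_simp
  ring

theorem bdryV_stress_eq (hO : IsOpen O) (h0 : (0 : E n) ∉ O)
    (hu : ContDiffOn ℝ 4 u O) {x : E n} (hx : x ∈ O) :
    bdryV (stress lam P p u) x = wt lam P (n - p) x * bdryA2 u x := by
  have hθ : ContDiffOn ℝ 3 (theta u) O := contDiffOn_theta hO hu (by norm_num)
  have dθ : DifferentiableAt ℝ (theta u) x := differentiableAt_of_contDiffOn hO hθ (by norm_num) hx
  have du : DifferentiableAt ℝ u x := differentiableAt_of_contDiffOn hO hu (by norm_num) hx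
  rw [bdryV_stress hO hu hx, bdryA2, lapS_eq hO h0 (hu.of_le (by norm_num)) hx, theta_sub dθ du,
    theta_add (dθ.const_mul _) (du.const_mul _), theta_const_mul, theta_const_mul]
  ring

theorem sum_pd_radialRow_stress (hK : IsConicalLocalization K lam) (hO : IsOpen O) (hOK : O ⊆ K)
    (hu : ContDiffOn ℝ 4 u O) {x : E n} (hx : x ∈ O) :
    ∑ j, pd j (radialRow (stress lam P p u) j) x =
      ∑ j, pd j (wt lam P (n - p)) x * pd j (fun y => theta u y - u y) x +
      wt lam P (n - p) x * (lap (fun y => theta u y - u y) x + ((n : ℝ) - 2) *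
        ((2 * n - 2 * p) * lap u x + theta (lap u) x)) := by
  set W := wt lam P (n - p)
  set g : E n → ℝ := fun y => theta u y - u y
  have hW : ContDiffOn ℝ 2 W O := (contDiffOn_wt hK).mono hOK
  have hg : ContDiffOn ℝ 3 g O :=
    (contDiffOn_theta hO hu (by norm_num)).sub (hu.of_le (by norm_num))
  have dW : DifferentiableAt ℝ W x := differentiableAt_of_contDiffOn hO hW (by norm_num) hx
  have dg : ∀ j, DifferentiableAt ℝ (pd j g) x := fun j =>
    differentiableAt_of_contDiffOn hO (contDiffOn_pd hO hg (m := 2) (by norm_num) j) (by norm_num) hx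
  have dL : DifferentiableAt ℝ (lap u) x :=
    differentiableAt_of_contDiffOn hO (contDiffOn_lap hO hu) (by norm_num) hx
  have dLx : ∀ j : Fin n, DifferentiableAt ℝ (fun y : E n => lap u y * y j) x := fun j =>
    dL.mul (differentiableAt_coord j x)
  have dsum : ∀ j : Fin n, DifferentiableAt ℝ
      (fun y : E n => pd j g y + ((n : ℝ) - 2) * (lap u y * y j)) x := fun j =>
    (dg j).add ((dLx j).const_mul _)
  have e : ∀ j, pd j (radialRow (stress lam P p u) j) x = pd j W x * pd j g x +
      W x * pd j (pd j g) x + ((n : ℝ) - 2) * (lap u x * (x j * pd j W x) +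
        W x * (x j * pd j (lap u) x) + W x * lap u x) := by
    intro j
    rw [pd_congr_of_eqOn hO hx fun y hy => radialRow_stress hO hu j hy, pd_mul dW (dsum j),
      pd_add (dg j) ((dLx j).const_mul _), pd_const_mul, pd_mul dL (differentiableAt_coord j x),
      pd_coord, if_pos rfl]
    ring
  have e2 : ∑ j, x j * pd j W x = (n - 2 * p) * W x := by
    rw [← theta_eq_sum, theta_wt hK (hOK hx)]
    ring
  simp only [e, Finset.sum_add_distrib, ← Finset.mul_sum, e2, ← theta_eq_sum, Finset.sum_const,
    Finset.card_univ, Fintype.card_fin, nsmul_eq_mul]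
  rw [← lap]
  ring

theorem divS_wt_dsl (hK : IsConicalLocalization K lam) {g : E n → ℝ} (hO : IsOpen O) (hOK : O ⊆ K)
    (hg : ContDiffOn ℝ 2 g O) {x : E n} (hx : x ∈ O) :
    divS (fun i y => lam y ^ (2 * P) * dsl i g y) x = lam x ^ (2 * P) * lapS g x +
      ‖x‖ ^ 2 * ∑ j, pd j (wt lam P (n / 2)) x * pd j g x := by
  have hx0 := hK.ne_zero (hOK hx)
  have dμ : DifferentiableAt ℝ (wt lam P (n / 2)) x :=
    differentiableAt_of_contDiffOn hK.isOpen (contDiffOn_wt hK) (by norm_num) (hOK hx)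
  have dn := differentiableAt_norm hx0
  have hr : ‖x‖ ≠ 0 := norm_ne_zero_iff.2 hx0
  have dd : ∀ i, DifferentiableAt ℝ (dsl i g) x := fun i => by
    have e1 : dsl i g = fun y => ‖y‖ * pd i g y - y i * (‖y‖⁻¹ * theta g y) := by
      ext y
      rw [dsl]
      ring
    rw [e1]
    exact (dn.mul (differentiableAt_of_contDiffOn hO (contDiffOn_pd hO hg one_add_one_le_two i)
      le_rfl hx)).sub ((differentiableAt_coord i x).mul ((dn.inv hr).mul
      (differentiableAt_of_contDiffOn hO (contDiffOn_theta hO hg one_add_one_le_two) le_rfl hx)))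
  have hθ : theta (wt lam P (n / 2)) x = 0 := by
    rw [theta_wt hK (hOK hx)]
    ring
  have e : ∀ i, dsl i (fun y => lam y ^ (2 * P) * dsl i g y) x = lam x ^ (2 * P) * dsl i (dsl i g) x +
      dsl i (wt lam P (n / 2)) x * dsl i g x := by
    intro i
    simp only [← wt_half]
    rw [dsl_mul dμ (dd i)]
    ring
  rw [divS]
  simp only [e, Finset.sum_add_distrib, ← Finset.mul_sum, sum_dsl_mul_dsl hx0, hθ, zero_mul, sub_zero]
  rfl

theorem bdryQ_stress_eq (hK : IsConicalLocalization K lam) (hO : IsOpen O) (hOK : O ⊆ K)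
    (hu : ContDiffOn ℝ 4 u O) {x : E n} (hx : x ∈ O) :
    bdryQ (stress lam P p u) x = wt lam P (n - p) x * bdryA3 lam P p u x := by
  have h0 : (0 : E n) ∉ O := fun h => hK.zero_notMem (hOK h)
  set g : E n → ℝ := fun y => theta u y - u y with hg_def
  have hθu : ContDiffOn ℝ 3 (theta u) O := contDiffOn_theta hO hu (by norm_num)
  have hθθu : ContDiffOn ℝ 2 (theta (theta u)) O := contDiffOn_theta hO hθu (by norm_num)
  have hg : ContDiffOn ℝ 3 g O := hθu.sub (hu.of_le (by norm_num))
  have hL : ContDiffOn ℝ 2 (lap u) O := contDiffOn_lap hO hu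
  have hW : ContDiffOn ℝ 2 (wt lam P (n - p)) O := (contDiffOn_wt hK).mono hOK
  have du : ∀ y ∈ O, DifferentiableAt ℝ u y := fun y hy =>
    differentiableAt_of_contDiffOn hO hu (by norm_num) hy
  have dθ : ∀ y ∈ O, DifferentiableAt ℝ (theta u) y := fun y hy =>
    differentiableAt_of_contDiffOn hO hθu (by norm_num) hy
  have dθθ : DifferentiableAt ℝ (theta (theta u)) x :=
    differentiableAt_of_contDiffOn hO hθθu (by norm_num) hx
  have dL : DifferentiableAt ℝ (lap u) x := differentiableAt_of_contDiffOn hO hL (by norm_num) hx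
  have dW : DifferentiableAt ℝ (wt lam P (n - p)) x :=
    differentiableAt_of_contDiffOn hO hW (by norm_num) hx
  have dr := differentiableAt_norm_sq x
  have drL : DifferentiableAt ℝ (fun y => ‖y‖ ^ 2 * lap u y) x := dr.mul dL
  have dθg : DifferentiableAt ℝ (theta g) x :=
    differentiableAt_of_contDiffOn hO (contDiffOn_theta hO hg (m := 2) (by norm_num)) (by norm_num) hx
  have θg : ∀ y ∈ O, theta g y = theta (theta u) y - theta u y := fun y hy =>
    theta_sub (dθ y hy) (du y hy)
  have θθg : theta (theta g) x = theta (theta (theta u)) x - theta (theta u) x := by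
    rw [theta_congr_of_eqOn hO hx θg, theta_sub dθθ (dθ x hx)]
  have θrL : theta (fun y => ‖y‖ ^ 2 * lap u y) x = ‖x‖ ^ 2 * theta (lap u) x +
      2 * (‖x‖ ^ 2 * lap u x) := by
    rw [theta_mul dr dL, theta_norm_sq]
    ring
  have lapg : lap g x = theta (lap u) x + lap u x := by
    have : lap g x = lap (theta u) x - lap u x := by
      simp only [lap, ← Finset.sum_sub_distrib]
      refine Finset.sum_congr rfl fun i _ => ?_
      rw [pd_congr_of_eqOn hO hx fun y hy => pd_sub (dθ y hy) (du y hy) i, pd_sub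
        (differentiableAt_of_contDiffOn hO (contDiffOn_pd hO hθu (m := 2) (by norm_num) i)
          (by norm_num) hx)
        (differentiableAt_of_contDiffOn hO (contDiffOn_pd hO hu (m := 3) (by norm_num) i)
          (by norm_num) hx)]
    rw [this, lap_theta hO (hu.of_le (by norm_num)) hx]
    ring
  have lapSg : lapS g x = ‖x‖ ^ 2 * lap g x - theta (theta g) x - ((n : ℝ) - 2) * theta g x :=
    lapS_eq hO h0 (hg.of_le (by norm_num)) hx
  have lapSu : ∀ y ∈ O, lapS u y = ‖y‖ ^ 2 * lap u y - theta (theta u) y -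
      ((n : ℝ) - 2) * theta u y := fun y hy => lapS_eq hO h0 (hu.of_le (by norm_num)) hy
  have θlapSu : theta (lapS u) x = ‖x‖ ^ 2 * theta (lap u) x + 2 * (‖x‖ ^ 2 * lap u x) -
      theta (theta (theta u)) x - ((n : ℝ) - 2) * theta (theta u) x := by
    rw [theta_congr_of_eqOn hO hx lapSu, theta_sub (a := fun y => ‖y‖ ^ 2 * lap u y - theta (theta u) y)
        (drL.sub dθθ) ((dθ x hx).const_mul _), theta_sub drL dθθ, θrL, theta_const_mul]
  have θbV : theta (bdryV (stress lam P p u)) x = wt lam P (n - p) x *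
      ((n - 2 * p) * (theta g x + ((n : ℝ) - 2) * (‖x‖ ^ 2 * lap u x)) + theta (theta g) x +
        ((n : ℝ) - 2) * (‖x‖ ^ 2 * theta (lap u) x + 2 * (‖x‖ ^ 2 * lap u x))) := by
    rw [theta_congr_of_eqOn hO hx fun y hy => bdryV_stress hO hu hy,
      theta_mul (b := fun y => theta g y + ((n : ℝ) - 2) * (‖y‖ ^ 2 * lap u y)) dW
        (dθg.add (drL.const_mul _)), theta_wt hK (hOK hx),
      theta_add dθg (drL.const_mul _), theta_const_mul, θrL]
    ring
  have first : theta (fun y => theta (theta u) y + aC n p * theta u y - bC n p * u y) x =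
      theta (theta (theta u)) x + aC n p * theta (theta u) x - bC n p * theta u x := by
    rw [theta_sub (a := fun y => theta (theta u) y + aC n p * theta u y)
        (dθθ.add ((dθ x hx).const_mul _)) ((du x hx).const_mul _),
      theta_add dθθ ((dθ x hx).const_mul _), theta_const_mul, theta_const_mul]
  have hl : lam x ^ (2 * P) ≠ 0 := (Real.rpow_pos_of_pos (hK.pos x (hOK hx)) _).ne'
  rw [bdryQ_eq hO (contDiffOn_stress hK hO hOK hu) hx, sum_pd_radialRow_stress hK hO hOK hu hx,
    mul_add, mul_assoc 2 (‖x‖ ^ 2) (∑ j, _), sum_pd_wt_mul hK _ (hOK hx), sum_stress_diag,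
    bdryV_stress hO hu hx, θbV, bdryA3, first,
    divS_wt_dsl hK hO hOK (hg.of_le (by norm_num)) hx, θlapSu, lapSu x hx, lapSg, ← hg_def, θθg,
    lapg, θg x hx, bC, aC]
  field_simp
  ring

theorem isClassicalSolution_of_isVariationalSolution (hn : 1 ≤ n)
    (hK : IsConicalLocalization K lam) (hR : 0 < R) {q : ℝ} (hf : MemWL2 K lam P R q f)
    (hvar : IsVariationalSolution K lam P R p f u) (hreg : IsRegular K R u) :
    IsClassicalSolution K lam P R p f u := by
  obtain ⟨U, hU, hsub, hu⟩ := hreg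
  have hO : IsOpen (K ∩ U) := hK.isOpen.inter hU
  have hOK : K ∩ U ⊆ K := inter_subset_left
  have hu' : ContDiffOn ℝ 4 u (K ∩ U) := hu.mono inter_subset_right
  have hOm : Om K R ⊆ K ∩ U := fun x hx => ⟨hx.1, hsub ⟨hx.1, show R ≤ ‖x‖ from (show R < ‖x‖ from hx.2).le⟩⟩
  have h0 : (0 : E n) ∉ K ∩ U := fun h => hK.zero_notMem h.1
  refine ⟨?_, fun x hx hxR => ?_⟩
  · rw [ae_restrict_iff' hK.isOpen_Om.measurableSet]
    exact hamOp_ae_eq hK hO hOK hOm hu' hvar hf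
  · have hxO : x ∈ K ∩ U := ⟨hx, hsub ⟨hx, show R ≤ ‖x‖ from hxR.ge⟩⟩
    obtain ⟨h1, h2⟩ := bdry_stress_eq_zero hn hR hK hO hOK hOm hu' hvar hf hxO hxR
    have hW := (wt_pos hK hx (P := P) (q := n - p)).ne'
    rw [bdryV_stress_eq hO h0 hu' hxO] at h1
    rw [bdryQ_stress_eq hK hO hOK hu' hxO] at h2
    exact ⟨(mul_eq_zero.1 h2).resolve_left hW, (mul_eq_zero.1 h1).resolve_left hW⟩

end LocHam

theorem mainTheorem11 (n : ℕ) (hn : 3 ≤ n) (K : Set (LocHam.E n)) (lam : LocHam.E n → ℝ)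
    (hK : LocHam.IsConicalLocalization K lam) (R : ℝ) (hR : 0 < R) (P : ℝ) (hP : 2 ≤ P)
    (p : ℝ) (hp : 0 < p) (hp' : p < (n : ℝ) - 2)
    (f : LocHam.E n → ℝ) (hf : LocHam.MemWL2 K lam P R ((n : ℝ) - p + 2) f) :
    (∃ u : LocHam.E n → ℝ, LocHam.IsVariationalSolution K lam P R p f u ∧
      ∀ v : LocHam.E n → ℝ, LocHam.IsVariationalSolution K lam P R p f v →
        v =ᵐ[volume.restrict (LocHam.Om K R)] u) ∧
    (∀ u : LocHam.E n → ℝ, LocHam.IsVariationalSolution K lam P R p f u →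
      LocHam.IsRegular K R u → LocHam.IsClassicalSolution K lam P R p f u) := by
  obtain ⟨u, hu⟩ := LocHam.exists_variationalSolution hK hn hp' hf
  exact ⟨⟨u, hu, fun _ hv => LocHam.variationalSolution_unique hK hn hp' hu hv⟩,
    fun _ hv hreg => LocHam.isClassicalSolution_of_isVariationalSolution (by lia) hK hR hf hv hreg⟩
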